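/- Let $\Psi:\mathbb R\to\mathbb R$ be $C^\infty$ and such that $\rho=e^{-\Psi}$ is a probability density with $\int x\rho(x)\,dx=0$, $\int x^2\rho(x)\,dx=1$, and $\Psi^{(p)}\in L^q(\rho(x)\,dx)$ for every integer $p\ge 1$ and every real $q\in[1,\infty)$. Then there is a constant $C>0$, depending only on $\Psi$, with the following property. Let $a_1,b_1,a_2,b_2,\dots$ be independent and identically distributed random variables with density $\rho$, on any probability space. For $N\ge 1$ put $$X_N(t)=\frac1{\sqrt N}\sum_{n=1}^N\Big\{a_n\cos\Big(\frac{nt}{N}\Big)+b_n\sin\Big(\frac{nt}{N}\Big)\Big\},\qquad t\in\mathbb R,$$ and, for a bounded interval $I\subset\mathbb R$ of length $|I|$, let $Z_{X_N}(I)\in\{0,1,2,\dots\}\cup\{\infty\}$ be the number of (distinct) zeros of $X_N$ in $I$. Then, for every bounded interval $I$ and every integer $N\ge1$, $Z_{X_N}(I)$ is a random variable (i.e. measurable), and: (1) for every integer $k\ge 1$, $$\mathbb P\big(Z_{X_N}(I)\ge k\big)\le C\,\big(k!\,(k-1)!\big)^{-1/2}\,|I|^{k-\frac12};$$ (2) for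 every real $r>1$, the series below converges and $$\mathbb E\big[Z_{X_N}(I)^r\big]\le C\left(\sum_{k=1}^\infty\frac{|I|^{\frac{2k-1}{2r}}}{(k!\,(k-1)!)^{\frac1{2r}}}\right)^{r}.$$ -/

import Mathlib

open MeasureTheory ProbabilityTheory
open scoped ENNReal NNReal

/-- The measure on `ℝ` with density `ρ = exp (-Ψ)` with respect to Lebesgue measure. -/
noncomputable def densityLaw (Ψ : ℝ → ℝ) : Measure ℝ :=
  volume.withDensity (fun x => ENNReal.ofReal (Real.exp (-Ψ x)))

/-- The standing assumptions on the common law of the coefficients: it has a density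
`ρ = exp (-Ψ)` with `Ψ` of class `C^∞`, it is centred with unit second moment, and every
derivative `Ψ^(p)`, `p ≥ 1`, lies in `L^q(exp (-Ψ x) dx)` for all finite `q ≥ 1`. -/
structure AdmissiblePotential (Ψ : ℝ → ℝ) : Prop where
  contDiff : ContDiff ℝ ((⊤ : ℕ∞) : WithTop ℕ∞) Ψ
  isProbabilityMeasure : IsProbabilityMeasure (densityLaw Ψ)
  sq_integrable : MemLp (fun x : ℝ => x) 2 (densityLaw Ψ)
  mean_zero : ∫ x, x ∂(densityLaw Ψ) = 0
  second_moment_one : ∫ x, x ^ 2 ∂(densityLaw Ψ) = 1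
  deriv_memLp : ∀ p : ℕ, 1 ≤ p → ∀ q : ℝ≥0, 1 ≤ q →
    MemLp (iteratedDeriv p Ψ) (q : ℝ≥0∞) (densityLaw Ψ)

/-- The random variables `a 0, a 1, …, b 0, b 1, …` are independent, and each has the density
`exp (-Ψ)`. Here `a n` and `b n` stand for the coefficients usually written with the
index `n + 1`. -/
structure IIDCoefficients {Ω : Type*} [MeasurableSpace Ω] (P : Measure Ω) (Ψ : ℝ → ℝ)
    (a b : ℕ → Ω → ℝ) : Prop where
  measurable_a : ∀ n, Measurable (a n)
  measurable_b : ∀ n, Measurable (b n)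
  indep : iIndepFun (Sum.elim a b) P
  law_a : ∀ n, P.map (a n) = densityLaw Ψ
  law_b : ∀ n, P.map (b n) = densityLaw Ψ

/-- The normalized random trigonometric polynomial
`X_N(t) = N^(-1/2) ∑_{n=1}^N (a_n cos (n t / N) + b_n sin (n t / N))`,
the summation index being shifted by one. -/
noncomputable def trigPoly {Ω : Type*} (a b : ℕ → Ω → ℝ) (N : ℕ) (ω : Ω) (t : ℝ) : ℝ :=
  1 / Real.sqrt (N : ℝ) * ∑ n ∈ Finset.range N,
    (a n ω * Real.cos (((n : ℝ) + 1) * t / (N : ℝ)) +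
      b n ω * Real.sin (((n : ℝ) + 1) * t / (N : ℝ)))

/-- The number of zeros of the function `f` lying in `I`, possibly infinite. -/
noncomputable def zeroCount (f : ℝ → ℝ) (I : Set ℝ) : ℕ∞ :=
  {t ∈ I | f t = 0}.encard

/-- The quantity `ℓ^((2k-1)/(2r)) / (k! (k-1)!)^(1/(2r))`, used for `k ≥ 1`. -/
noncomputable def momentTerm (ℓ r : ℝ) (k : ℕ) : ℝ :=
  ℓ ^ ((2 * (k : ℝ) - 1) / (2 * r)) /
    ((k.factorial : ℝ) * ((k - 1).factorial : ℝ)) ^ (1 / (2 * r))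

/-! Many zeros force smallness at one fixed point. If f has m + 1 zeros in [α, β], of length ℓ, then
by Rolle f^(m) has a zero, so |f^(m)| ≤ √ℓ ‖f^(m+1)‖ in L²([α, β]). Interpolation at m of the zeros
then gives |f(c)| ≤ ε ‖f^(m+1)‖ at the midpoint c, with ε = (ℓ/2)^m √ℓ / m! (`abs_midpoint_le`).

For f = X_N, f(c) is a linear form in the coefficients whose weights have square sum 1, and f^(m+1)
is a combination of fixed vectors v_i of a Hilbert space with T = ∑ ‖v_i‖² ≤ ℓ. The small ball
estimate `measureReal_abs_sum_le_mul_norm` bounds the probability of the event by K (1 + T) ε, where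
K = 8 + 2 ∫ Ψ'² ρ, so nothing depends on N. It comes from integrating by parts ε y arctan(σ / (ε
y)), with σ the linear form and y a smoothed norm: the derivative along the weights is at least 1/2
- O(ε) on the event, while its expectation is O(ε), being the test function paired with the score ∑
h_i Ψ'(ξ_i).

The factor 2^(-m) gained at the midpoint absorbs 1 + ℓ and the missing √(m + 1)
(`le_of_le_midpoint_bound`). The moments follow by Minkowski's inequality for Z = ∑_k 1_{Z ≥ k}. -/

theorem integrable_densityLaw_iff {Ψ : ℝ → ℝ} (hΨ : Continuous Ψ) (φ : ℝ → ℝ) :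
    Integrable φ (densityLaw Ψ) ↔ Integrable (fun x => Real.exp (-Ψ x) * φ x) := by
  unfold densityLaw
  rw [integrable_withDensity_iff_integrable_smul' (by fun_prop) (by simp)]
  simp [ENNReal.toReal_ofReal, Real.exp_nonneg]

theorem integral_densityLaw {Ψ : ℝ → ℝ} (hΨ : Continuous Ψ) (φ : ℝ → ℝ) :
    ∫ x, φ x ∂(densityLaw Ψ) = ∫ x, Real.exp (-Ψ x) * φ x := by
  unfold densityLaw
  rw [integral_withDensity_eq_integral_toReal_smul (by fun_prop) (by simp)]
  simp [ENNReal.toReal_ofReal, Real.exp_nonneg]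

/-! ### Integration by parts against the law of one coefficient. -/

namespace AdmissiblePotential

variable {Ψ : ℝ → ℝ}

theorem hasDerivAt (hΨ : AdmissiblePotential Ψ) (x : ℝ) : HasDerivAt Ψ (deriv Ψ x) x :=
  (hΨ.contDiff.differentiable (by simp) x).hasDerivAt

theorem continuous_deriv (hΨ : AdmissiblePotential Ψ) : Continuous (deriv Ψ) :=
  hΨ.contDiff.continuous_deriv (by simp)

theorem memLp_deriv (hΨ : AdmissiblePotential Ψ) : MemLp (deriv Ψ) 2 (densityLaw Ψ) := by
  simpa using hΨ.deriv_memLp 1 le_rfl 2 (by norm_num)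

/-- Integration by parts against the density `exp (-Ψ)`. -/
theorem integral_deriv_eq (hΨ : AdmissiblePotential Ψ) {φ φ' : ℝ → ℝ}
    (hφ : ∀ x, HasDerivAt φ (φ' x) x) (h : Integrable φ (densityLaw Ψ))
    (h' : Integrable φ' (densityLaw Ψ))
    (hs : Integrable (fun x => φ x * deriv Ψ x) (densityLaw Ψ)) :
    ∫ x, φ' x ∂(densityLaw Ψ) = ∫ x, φ x * deriv Ψ x ∂(densityLaw Ψ) := by
  have hc := hΨ.contDiff.continuous
  -- Weighted by exp (-Ψ), the difference φ' - φ Ψ' is the derivative of exp (-Ψ) φ. Both are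
  -- integrable, so the integral vanishes and no decay at infinity has to be checked.
  rw [← sub_eq_zero, ← integral_sub h' hs, integral_densityLaw hc]
  have hd := integrable_densityLaw_iff hc _ |>.1 (h'.sub hs)
  refine integral_eq_zero_of_hasDerivAt_of_integrable (f := fun x => Real.exp (-Ψ x) * φ x)
    (fun x => ?_) hd ((integrable_densityLaw_iff hc _).1 h)
  refine ((hΨ.hasDerivAt x).neg.exp.mul (hφ x)).congr_deriv ?_
  simp only [Pi.neg_apply]
  ring

theorem integral_deriv_eq_zero (hΨ : AdmissiblePotential Ψ) :
    ∫ x, deriv Ψ x ∂(densityLaw Ψ) = 0 := by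
  have := hΨ.isProbabilityMeasure
  have h := hΨ.integral_deriv_eq (φ := fun _ => 1) (φ' := fun _ => 0)
    (fun x => hasDerivAt_const x 1) (integrable_const _) (integrable_const _)
    (by simpa using hΨ.memLp_deriv.integrable (by norm_num))
  simpa using h.symm

/-- Integration by parts in one variable, the other variable being independent of it. -/
theorem integral_deriv_eq_of_indepFun (hΨ : AdmissiblePotential Ψ)
    {Ω β : Type*} [MeasurableSpace Ω] [MeasurableSpace β] {P : Measure Ω} [IsProbabilityMeasure P]
    {U : Ω → ℝ} {W : Ω → β} (hU : Measurable U) (hW : Measurable W) (hUW : IndepFun U W P)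
    (hlaw : P.map U = densityLaw Ψ) {F F' : ℝ → β → ℝ}
    (hF : Measurable (Function.uncurry F)) (hF' : Measurable (Function.uncurry F'))
    (hd : ∀ x w, HasDerivAt (fun x => F x w) (F' x w) x)
    (h : Integrable (fun ω => F (U ω) (W ω)) P) (h' : Integrable (fun ω => F' (U ω) (W ω)) P)
    (hs : Integrable (fun ω => F (U ω) (W ω) * deriv Ψ (U ω)) P) :
    ∫ ω, F' (U ω) (W ω) ∂P = ∫ ω, F (U ω) (W ω) * deriv Ψ (U ω) ∂P := by
  have := hΨ.isProbabilityMeasure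
  have : IsProbabilityMeasure (P.map W) := Measure.isProbabilityMeasure_map hW.aemeasurable
  have hm : P.map (fun ω => (U ω, W ω)) = (densityLaw Ψ).prod (P.map W) := by
    rw [(indepFun_iff_map_prod_eq_prod_map_map hU.aemeasurable hW.aemeasurable).1 hUW, hlaw]
  have hUWm : AEMeasurable (fun ω => (U ω, W ω)) P := (hU.prodMk hW).aemeasurable
  have hS : Measurable (fun p : ℝ × β => F p.1 p.2 * deriv Ψ p.1) :=
    hF.mul (hΨ.continuous_deriv.measurable.comp measurable_fst)
  have key : ∀ G : ℝ × β → ℝ, Measurable G → Integrable (fun ω => G (U ω, W ω)) P →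
      Integrable G ((densityLaw Ψ).prod (P.map W)) ∧ ∫ ω, G (U ω, W ω) ∂P =
        ∫ w, ∫ x, G (x, w) ∂(densityLaw Ψ) ∂(P.map W) := by
    intro G hG hGi
    have hi : Integrable G ((densityLaw Ψ).prod (P.map W)) := by
      rw [← hm]
      exact (integrable_map_measure hG.aestronglyMeasurable hUWm).2 hGi
    refine ⟨hi, ?_⟩
    rw [← integral_prod_symm G hi, ← hm, integral_map hUWm hG.aestronglyMeasurable]
  obtain ⟨i1, -⟩ := key _ hF h
  obtain ⟨i2, e2⟩ := key _ hF' h'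
  obtain ⟨i3, e3⟩ := key _ hS hs
  refine e2.trans (Eq.trans ?_ e3.symm)
  refine integral_congr_ae ?_
  filter_upwards [i1.prod_left_ae, i2.prod_left_ae, i3.prod_left_ae] with w h1 h2 h3
  exact hΨ.integral_deriv_eq (fun x => hd x w) h1 h2 h3

end AdmissiblePotential

/-! ### Second moments of independent sums with vector weights. -/

section Variance

variable {Ω ι H : Type*} [MeasurableSpace Ω] {P : Measure Ω} [Fintype ι]
  [NormedAddCommGroup H] [InnerProductSpace ℝ H]

theorem norm_sum_smul_sq (x : ι → ℝ) (v : ι → H) :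
    ‖∑ i, x i • v i‖ ^ 2 = ∑ i, ∑ j, x i * x j * inner ℝ (v i) (v j) := by
  rw [← real_inner_self_eq_norm_sq, sum_inner]
  simp only [inner_sum, real_inner_smul_left, real_inner_smul_right]
  exact Finset.sum_congr rfl fun i _ => Finset.sum_congr rfl fun j _ => by ring

theorem integrable_norm_sum_smul_sq {η : ι → Ω → ℝ} (hL : ∀ i, MemLp (η i) 2 P) (v : ι → H) :
    Integrable (fun ω => ‖∑ i, η i ω • v i‖ ^ 2) P := by
  simp only [norm_sum_smul_sq]
  exact integrable_finsetSum _ fun i _ => integrable_finsetSum _ fun j _ =>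
    ((hL i).integrable_mul (hL j)).mul_const _

/-- Sums of independent centred variables times fixed vectors: the second moment is additive. -/
theorem integral_norm_sum_smul_sq {η : ι → Ω → ℝ} (hind : iIndepFun η P)
    (hL : ∀ i, MemLp (η i) 2 P) (h0 : ∀ i, ∫ ω, η i ω ∂P = 0) {s : ℝ}
    (hs : ∀ i, ∫ ω, η i ω ^ 2 ∂P = s) (v : ι → H) :
    ∫ ω, ‖∑ i, η i ω • v i‖ ^ 2 ∂P = s * ∑ i, ‖v i‖ ^ 2 := by
  classical
  simp only [norm_sum_smul_sq]
  have hint : ∀ i j, Integrable (fun ω => η i ω * η j ω * inner ℝ (v i) (v j)) P :=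
    fun i j => ((hL i).integrable_mul (hL j)).mul_const _
  rw [integral_finsetSum _ fun i _ => integrable_finsetSum _ fun j _ => hint i j, Finset.mul_sum]
  refine Finset.sum_congr rfl fun i _ => ?_
  rw [integral_finsetSum _ fun j _ => hint i j, Finset.sum_eq_single i]
  · rw [integral_mul_const, real_inner_self_eq_norm_sq, ← hs i]
    simp only [sq]
  · intro j _ hj
    rw [integral_mul_const, (hind.indepFun hj.symm).integral_fun_mul_eq_mul_integral
      (hL i).aestronglyMeasurable (hL j).aestronglyMeasurable, h0 i]
    simp
  · simp

end Variance

/-- Derivative of `ε y arctan (σ / (ε y))`. -/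
theorem hasDerivAt_mul_arctan_div {σ y : ℝ → ℝ} {σ' y' s ε : ℝ} (hσ : HasDerivAt σ σ' s)
    (hy : HasDerivAt y y' s) (hy0 : y s ≠ 0) (hε : ε ≠ 0) :
    HasDerivAt (fun s => ε * y s * Real.arctan (σ s / (ε * y s)))
      (σ' / (1 + (σ s / (ε * y s)) ^ 2) + ε * y' * (Real.arctan (σ s / (ε * y s)) -
        (σ s / (ε * y s)) / (1 + (σ s / (ε * y s)) ^ 2))) s := by
  have h1 := hy.const_mul ε
  have h0 : ε * y s ≠ 0 := mul_ne_zero hε hy0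
  refine (h1.mul (hσ.div h1 h0).arctan).congr_deriv ?_
  have h2 : 1 + (σ s / (ε * y s)) ^ 2 ≠ 0 := by positivity
  simp only [Pi.div_apply]
  generalize hu : σ s / (ε * y s) = u at *
  have hs : σ s = u * (ε * y s) := by rw [← hu]; field_simp
  rw [hs]
  field_simp
  ring

/-- This is the factor left when the derivative falls on the prefactor ε y. The constant is π/2 < 2
plus 1. -/
theorem abs_arctan_sub_le (u : ℝ) : |Real.arctan u - u / (1 + u ^ 2)| ≤ 3 := by
  have h1 := Real.arctan_lt_pi_div_two u
  have h2 := Real.neg_pi_div_two_lt_arctan u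
  have h3 := Real.pi_lt_four
  have h4 : |u / (1 + u ^ 2)| ≤ 1 := by
    rw [abs_div, abs_of_pos (show 0 < 1 + u ^ 2 by positivity), div_le_one (by positivity)]
    nlinarith [sq_abs u, sq_nonneg (|u| - 1), abs_nonneg u]
  rw [abs_le] at h4 ⊢
  constructor <;> linarith

/-! ### Pointwise bounds for the arctangent test function. -/

section SmallBall

variable {ι H : Type*} [Fintype ι] [NormedAddCommGroup H] [InnerProductSpace ℝ H]

/-- A smooth and positive substitute for the norm of `∑ i, x i • v i`. -/
noncomputable def regNorm (v : ι → H) (x : ι → ℝ) : ℝ := √(1 + ‖∑ i, x i • v i‖ ^ 2)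

theorem regNorm_pos (v : ι → H) (x : ι → ℝ) : 0 < regNorm v x := by
  unfold regNorm; positivity

theorem regNorm_sq (v : ι → H) (x : ι → ℝ) : regNorm v x ^ 2 = 1 + ‖∑ i, x i • v i‖ ^ 2 :=
  Real.sq_sqrt (by positivity)

theorem norm_le_regNorm (v : ι → H) (x : ι → ℝ) : ‖∑ i, x i • v i‖ ≤ regNorm v x :=
  Real.le_sqrt_of_sq_le (by linarith)

theorem continuous_regNorm (v : ι → H) : Continuous (regNorm v) := by
  unfold regNorm; fun_prop

theorem hasDerivAt_regNorm (v : ι → H) (w e : ι → ℝ) (s : ℝ) :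
    HasDerivAt (fun s : ℝ => regNorm v (w + s • e))
      (inner ℝ (∑ i, (w + s • e) i • v i) (∑ i, e i • v i) / regNorm v (w + s • e)) s := by
  have hl : ∀ s : ℝ, ∑ i, (w + s • e) i • v i = ∑ i, w i • v i + s • ∑ i, e i • v i := fun s => by
    simp [add_smul, Finset.sum_add_distrib, mul_smul, Finset.smul_sum]
  have h1 : HasDerivAt (fun s : ℝ => ∑ i, (w + s • e) i • v i) (∑ i, e i • v i) s := by
    simp only [hl]
    simpa using ((hasDerivAt_id s).smul_const (∑ i, e i • v i)).const_add (∑ i, w i • v i)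
  have h2 := (h1.norm_sq.const_add 1).sqrt (by positivity)
  unfold regNorm
  refine h2.congr_deriv ?_
  rw [mul_div_mul_left _ _ two_ne_zero]

/-- The quotient of a linear form by the regularised norm, at scale `ε`. -/
noncomputable def scaledQuotient (h : ι → ℝ) (v : ι → H) (ε : ℝ) (x : ι → ℝ) : ℝ :=
  (∑ i, x i * h i) / (ε * regNorm v x)

/-- The test function for the integration by parts: a bounded function of `scaledQuotient`,
times the regularised norm. -/
noncomputable def smallBallTest (h : ι → ℝ) (v : ι → H) (ε : ℝ) (x : ι → ℝ) : ℝ :=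
  ε * regNorm v x * Real.arctan (scaledQuotient h v ε x)

/-- The derivative of `smallBallTest` in direction `e`. -/
noncomputable def smallBallTestDeriv (h : ι → ℝ) (v : ι → H) (ε : ℝ) (e x : ι → ℝ) : ℝ :=
  (∑ i, e i * h i) / (1 + scaledQuotient h v ε x ^ 2) +
    ε * (inner ℝ (∑ i, x i • v i) (∑ i, e i • v i) / regNorm v x) *
      (Real.arctan (scaledQuotient h v ε x) -
        scaledQuotient h v ε x / (1 + scaledQuotient h v ε x ^ 2))

variable {h : ι → ℝ} {v : ι → H} {ε : ℝ}

theorem hasDerivAt_smallBallTest (hε : 0 < ε) (w e : ι → ℝ) (s : ℝ) :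
    HasDerivAt (fun s : ℝ => smallBallTest h v ε (w + s • e))
      (smallBallTestDeriv h v ε e (w + s • e)) s := by
  have h1 : HasDerivAt (fun s : ℝ => ∑ i, (w + s • e) i * h i) (∑ i, e i * h i) s := by
    refine HasDerivAt.fun_sum fun i _ => ?_
    simpa using (((hasDerivAt_id s).mul_const (e i)).const_add (w i)).mul_const (h i)
  exact hasDerivAt_mul_arctan_div h1 (hasDerivAt_regNorm v w e s) (regNorm_pos _ _).ne' hε.ne'

theorem continuous_scaledQuotient (hε : 0 < ε) : Continuous (scaledQuotient h v ε) := by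
  unfold scaledQuotient
  have := continuous_regNorm v
  exact Continuous.div (by fun_prop) (by fun_prop) fun x =>
    (mul_pos hε (regNorm_pos v x)).ne'

theorem continuous_smallBallTest (hε : 0 < ε) : Continuous (smallBallTest h v ε) := by
  unfold smallBallTest
  have := continuous_regNorm v
  have := continuous_scaledQuotient (h := h) (v := v) hε
  fun_prop

theorem continuous_smallBallTestDeriv (hε : 0 < ε) (e : ι → ℝ) :
    Continuous (smallBallTestDeriv h v ε e) := by
  unfold smallBallTestDeriv
  have h1 := continuous_regNorm v
  have h2 := continuous_scaledQuotient (h := h) (v := v) hε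
  have h3 : ∀ x : ι → ℝ, 1 + scaledQuotient h v ε x ^ 2 ≠ 0 := fun x => by positivity
  have h4 : ∀ x : ι → ℝ, regNorm v x ≠ 0 := fun x => (regNorm_pos v x).ne'
  fun_prop (disch := assumption)

theorem abs_smallBallTest_le (hε : 0 < ε) (x : ι → ℝ) :
    |smallBallTest h v ε x| ≤ 2 * ε * regNorm v x := by
  have h1 := Real.arctan_lt_pi_div_two (scaledQuotient h v ε x)
  have h2 := Real.neg_pi_div_two_lt_arctan (scaledQuotient h v ε x)
  have h3 := Real.pi_lt_four
  have h4 : |Real.arctan (scaledQuotient h v ε x)| ≤ 2 := by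
    rw [abs_le]; constructor <;> linarith
  have h5 := mul_pos hε (regNorm_pos v x)
  rw [smallBallTest, abs_mul, abs_of_pos h5]
  nlinarith

/-- By Cauchy–Schwarz the directional derivative of `regNorm` is at most the norm of the image of
the direction. The bound does not involve x, so the error term is deterministic. -/
theorem abs_correction_le (hε : 0 < ε) (e x : ι → ℝ) :
    |ε * (inner ℝ (∑ i, x i • v i) (∑ i, e i • v i) / regNorm v x) *
      (Real.arctan (scaledQuotient h v ε x) -
        scaledQuotient h v ε x / (1 + scaledQuotient h v ε x ^ 2))| ≤
      3 * ε * ‖∑ i, e i • v i‖ := by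
  have h1 : |inner ℝ (∑ i, x i • v i) (∑ i, e i • v i) / regNorm v x| ≤ ‖∑ i, e i • v i‖ := by
    rw [abs_div, abs_of_pos (regNorm_pos v x), div_le_iff₀ (regNorm_pos v x), mul_comm]
    exact (abs_real_inner_le_norm _ _).trans
      (mul_le_mul_of_nonneg_right (norm_le_regNorm v x) (norm_nonneg _))
  rw [abs_mul, abs_mul, abs_of_pos hε]
  calc _ ≤ ε * ‖∑ i, e i • v i‖ * 3 := by gcongr; exact abs_arctan_sub_le _
    _ = _ := by ring

theorem abs_smallBallTestDeriv_le (hε : 0 < ε) (e x : ι → ℝ) :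
    |smallBallTestDeriv h v ε e x| ≤ |∑ i, e i * h i| + 3 * ε * ‖∑ i, e i • v i‖ := by
  refine (abs_add_le _ _).trans (add_le_add ?_ (abs_correction_le hε e x))
  rw [abs_div, abs_of_pos (show 0 < 1 + scaledQuotient h v ε x ^ 2 by positivity)]
  exact div_le_self (abs_nonneg _) (by nlinarith [sq_nonneg (scaledQuotient h v ε x)])

/-- Linearity in the direction reduces the derivative along h to coordinate derivatives, where
one-variable integration by parts applies. -/
theorem smallBallTestDeriv_eq_sum [DecidableEq ι] (e x : ι → ℝ) :
    smallBallTestDeriv h v ε e x =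
      ∑ i, e i * smallBallTestDeriv h v ε (Pi.single i 1) x := by
  unfold smallBallTestDeriv
  simp only [mul_add, Finset.sum_add_distrib]
  congr 1
  · simp [Finset.sum_div, Pi.single_apply, mul_div_assoc]
  · rw [inner_sum, Finset.sum_div, Finset.mul_sum, Finset.sum_mul]
    refine Finset.sum_congr rfl fun i _ => ?_
    simp only [Pi.single_apply, ite_smul, one_smul, zero_smul, Finset.sum_ite_eq',
      Finset.mem_univ, if_true, real_inner_smul_right]
    ring

/-- The indicator of the small ball event, bounded by the derivative of the test function in the
direction of the linear form. -/
theorem one_le_smallBallTestDeriv (hh : ∑ i, h i ^ 2 = 1) (hε : 0 < ε) (x : ι → ℝ)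
    (hx : |∑ i, x i * h i| ≤ ε * ‖∑ i, x i • v i‖) :
    1 ≤ 2 * smallBallTestDeriv h v ε h x + 6 * ε * ‖∑ i, h i • v i‖ := by
  have h1 := abs_le.1 (abs_correction_le (h := h) (v := v) hε h x)
  have h2 : scaledQuotient h v ε x ^ 2 ≤ 1 := by
    rw [sq_le_one_iff_abs_le_one, scaledQuotient, abs_div,
      abs_of_pos (mul_pos hε (regNorm_pos v x)), div_le_one (mul_pos hε (regNorm_pos v x))]
    exact hx.trans (mul_le_mul_of_nonneg_left (norm_le_regNorm v x) hε.le)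
  have h3 : 1 / 2 ≤ 1 / (1 + scaledQuotient h v ε x ^ 2) :=
    one_div_le_one_div_of_le (by positivity) (by linarith)
  have h4 : ∑ i, h i * h i = 1 := by simpa [sq] using hh
  unfold smallBallTestDeriv
  rw [h4]
  linarith [h1.1]

/-- Together with `one_le_smallBallTestDeriv`, this lets the same expression dominate the indicator
of the event everywhere. -/
theorem nonneg_smallBallTestDeriv (hh : ∑ i, h i ^ 2 = 1) (hε : 0 < ε) (x : ι → ℝ) :
    0 ≤ 2 * smallBallTestDeriv h v ε h x + 6 * ε * ‖∑ i, h i • v i‖ := by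
  have h1 := abs_le.1 (abs_correction_le (h := h) (v := v) hε h x)
  have h3 : 0 ≤ 1 / (1 + scaledQuotient h v ε x ^ 2) := by positivity
  have h4 : ∑ i, h i * h i = 1 := by simpa [sq] using hh
  unfold smallBallTestDeriv
  rw [h4]
  linarith [h1.1]

theorem norm_sum_smul_le_one_add (hh : ∑ i, h i ^ 2 = 1) :
    ‖∑ i, h i • v i‖ ≤ 1 + ∑ i, ‖v i‖ ^ 2 := by
  have h1 : ‖∑ i, h i • v i‖ ≤ ∑ i, |h i| * ‖v i‖ :=
    (norm_sum_le _ _).trans (Finset.sum_le_sum fun i _ => by rw [norm_smul, Real.norm_eq_abs])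
  have h2 : ∑ i, |h i| * ‖v i‖ ≤ ∑ i, (h i ^ 2 + ‖v i‖ ^ 2) :=
    Finset.sum_le_sum fun i _ => by
      nlinarith [sq_abs (h i), sq_nonneg (|h i| - ‖v i‖), sq_nonneg (|h i|), sq_nonneg ‖v i‖]
  rw [Finset.sum_add_distrib, hh] at h2
  exact h1.trans h2

end SmallBall

/-! ### The small ball estimate. -/

section SmallBallProbability

variable {Ω ι H : Type*} [MeasurableSpace Ω] {P : Measure Ω} [Fintype ι]
  [NormedAddCommGroup H] [InnerProductSpace ℝ H] {Ψ : ℝ → ℝ} {ξ : ι → Ω → ℝ}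
  {h : ι → ℝ} {v : ι → H} {ε : ℝ}

theorem integral_comp_of_map_eq {β : Type*} [MeasurableSpace β] {μ : Measure β} {U : Ω → β}
    (hU : Measurable U) (hlaw : P.map U = μ) {g : β → ℝ} (hg : Measurable g) :
    ∫ ω, g (U ω) ∂P = ∫ x, g x ∂μ := by
  rw [← hlaw, integral_map hU.aemeasurable hg.aestronglyMeasurable]

theorem memLp_comp_of_map_eq {β : Type*} [MeasurableSpace β] {μ : Measure β} {U : Ω → β}
    (hU : Measurable U) (hlaw : P.map U = μ) {g : β → ℝ} {p : ℝ≥0∞} (hg : MemLp g p μ) :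
    MemLp (fun ω => g (U ω)) p P := by
  subst hlaw
  exact hg.comp_of_map hU.aemeasurable

/-- Replacing one coordinate of an independent family by `0` makes it independent of that
coordinate. -/
theorem indepFun_update_zero [DecidableEq ι] (hm : ∀ i, Measurable (ξ i)) (hind : iIndepFun ξ P)
    (i : ι) : IndepFun (ξ i) (fun ω => Function.update (fun j => ξ j ω) i 0) P := by
  have h1 := hind.indepFun_finset {i} (Finset.univ.erase i) (by simp) hm
  have h2 : Measurable (fun w : ({i} : Finset ι) → ℝ => w ⟨i, by simp⟩) := measurable_pi_apply _
  have h3 : Measurable (fun (w : ((Finset.erase Finset.univ i : Finset ι)) → ℝ) (j : ι) =>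
      if hj : j ∈ Finset.univ.erase i then w ⟨j, hj⟩ else 0) := by
    refine measurable_pi_lambda _ fun j => ?_
    by_cases hj : j ∈ Finset.univ.erase i
    · simp only [hj, dif_pos]; exact measurable_pi_apply _
    · simp only [hj, dif_neg, not_false_eq_true]; exact measurable_const
  convert h1.comp h2 h3 using 1
  · rfl
  funext ω j
  by_cases hj : j = i
  · subst hj; simp
  · simp [hj]

variable [IsProbabilityMeasure P]

/-- Square integrability makes the product with the square integrable score Ψ'(ξ_i) integrable. -/
theorem memLp_smallBallTest (hΨ : AdmissiblePotential Ψ) (hm : ∀ i, Measurable (ξ i))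
    (hlaw : ∀ i, P.map (ξ i) = densityLaw Ψ) (hε : 0 < ε) :
    MemLp (fun ω => smallBallTest h v ε fun j => ξ j ω) 2 P := by
  have hmeas : Measurable fun ω => smallBallTest h v ε fun j => ξ j ω :=
    (continuous_smallBallTest hε).measurable.comp (measurable_pi_lambda _ hm)
  refine (memLp_two_iff_integrable_sq hmeas.aestronglyMeasurable).2 ?_
  have hi := integrable_norm_sum_smul_sq
    (fun i => memLp_comp_of_map_eq (hm i) (hlaw i) hΨ.sq_integrable) v
  refine Integrable.mono' (((integrable_const (1 : ℝ)).add hi).const_mul (4 * ε ^ 2))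
    (hmeas.pow_const 2).aestronglyMeasurable (Filter.Eventually.of_forall fun ω => ?_)
  have h1 := pow_le_pow_left₀ (abs_nonneg _)
    (abs_smallBallTest_le (h := h) (v := v) hε fun j => ξ j ω) 2
  rw [mul_pow, regNorm_sq, sq_abs] at h1
  rw [Real.norm_eq_abs, abs_of_nonneg (sq_nonneg _)]
  refine h1.trans (le_of_eq ?_)
  simp only [Pi.add_apply]
  ring

theorem integrable_smallBallTestDeriv (hm : ∀ i, Measurable (ξ i)) (hε : 0 < ε) (e : ι → ℝ) :
    Integrable (fun ω => smallBallTestDeriv h v ε e fun j => ξ j ω) P := by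
  refine Integrable.mono' (integrable_const (|∑ i, e i * h i| + 3 * ε * ‖∑ i, e i • v i‖))
    ((continuous_smallBallTestDeriv hε e).measurable.comp
      (measurable_pi_lambda _ hm)).aestronglyMeasurable
    (Filter.Eventually.of_forall fun ω => abs_smallBallTestDeriv_le hε e _)

theorem integral_smallBallTestDeriv_single [DecidableEq ι] (hΨ : AdmissiblePotential Ψ)
    (hm : ∀ i, Measurable (ξ i)) (hind : iIndepFun ξ P)
    (hlaw : ∀ i, P.map (ξ i) = densityLaw Ψ) (hε : 0 < ε) (i : ι) :
    ∫ ω, smallBallTestDeriv h v ε (Pi.single i 1) (fun j => ξ j ω) ∂P =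
      ∫ ω, smallBallTest h v ε (fun j => ξ j ω) * deriv Ψ (ξ i ω) ∂P := by
  -- The coefficient vector is split into its i-th coordinate and an independent remainder, so that
  -- coordinate alone is differentiated.
  have hrec : ∀ ω, (Function.update (fun j => ξ j ω) i 0 + ξ i ω • Pi.single i 1 : ι → ℝ) =
      fun j => ξ j ω := fun ω => by
    ext j
    by_cases hj : j = i
    · subst hj; simp
    · simp [hj]
  have hc : Continuous fun p : ℝ × (ι → ℝ) => (p.2 + p.1 • Pi.single i 1 : ι → ℝ) := by fun_prop
  have hW : Measurable fun ω => Function.update (fun j => ξ j ω) i (0 : ℝ) := by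
    refine measurable_pi_lambda _ fun j => ?_
    by_cases hj : j = i
    · subst hj; simp
    · simpa [hj] using hm j
  have hL := memLp_smallBallTest (h := h) (v := v) hΨ hm hlaw hε
  have hI := integrable_smallBallTestDeriv (h := h) (v := v) (P := P) hm hε (Pi.single i 1)
  have hs : Integrable
      (fun ω => smallBallTest h v ε (fun j => ξ j ω) * deriv Ψ (ξ i ω)) P :=
    hL.integrable_mul (memLp_comp_of_map_eq (hm i) (hlaw i) hΨ.memLp_deriv)
  have hF : Measurable (Function.uncurry fun (s : ℝ) (w : ι → ℝ) =>
      smallBallTest h v ε (w + s • Pi.single i 1)) :=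
    ((continuous_smallBallTest hε).comp hc).measurable
  have hF' : Measurable (Function.uncurry fun (s : ℝ) (w : ι → ℝ) =>
      smallBallTestDeriv h v ε (Pi.single i 1) (w + s • Pi.single i 1)) :=
    ((continuous_smallBallTestDeriv hε _).comp hc).measurable
  have hd := fun (s : ℝ) (w : ι → ℝ) =>
    hasDerivAt_smallBallTest (h := h) (v := v) hε w (Pi.single i 1) s
  generalize smallBallTest h v ε = F at *
  generalize smallBallTestDeriv h v ε (Pi.single i 1) = F' at *
  have := hΨ.integral_deriv_eq_of_indepFun (hm i) hW (indepFun_update_zero hm hind i) (hlaw i)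
    (F := fun s w => F (w + s • Pi.single i 1)) (F' := fun s w => F' (w + s • Pi.single i 1))
    hF hF' hd
    (by simpa only [hrec] using hL.integrable (by norm_num))
    (by simpa only [hrec] using hI) (by simpa only [hrec] using hs)
  simpa only [hrec] using this

/-- Small ball estimate: a normalised linear form in the coefficients is rarely small compared
with the norm of a linear function of the coefficients. -/
theorem measureReal_abs_sum_le_mul_norm (hΨ : AdmissiblePotential Ψ)
    (hm : ∀ i, Measurable (ξ i)) (hind : iIndepFun ξ P)
    (hlaw : ∀ i, P.map (ξ i) = densityLaw Ψ) (hh : ∑ i, h i ^ 2 = 1) (v : ι → H) (hε : 0 ≤ ε) :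
    P.real {ω | |∑ i, ξ i ω * h i| ≤ ε * ‖∑ i, ξ i ω • v i‖} ≤
      (8 + 2 * ∫ x, deriv Ψ x ^ 2 ∂(densityLaw Ψ)) * (1 + ∑ i, ‖v i‖ ^ 2) * ε := by
  classical
  set κ := ∫ x, deriv Ψ x ^ 2 ∂(densityLaw Ψ) with hκ
  set T := ∑ i, ‖v i‖ ^ 2 with hT
  have hκ0 : 0 ≤ κ := integral_nonneg fun x => sq_nonneg _
  have hT0 : 0 ≤ T := Finset.sum_nonneg fun i _ => sq_nonneg _
  have pos : ∀ δ : ℝ, 0 < δ →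
      P.real {ω | |∑ i, ξ i ω * h i| ≤ δ * ‖∑ i, ξ i ω • v i‖} ≤
        (8 + 2 * κ) * (1 + T) * δ := by
    intro δ hδ
    have hdm := hΨ.continuous_deriv.measurable
    have hL := memLp_smallBallTest (h := h) (v := v) hΨ hm hlaw hδ
    have hsc : ∀ i, MemLp (fun ω => deriv Ψ (ξ i ω)) 2 P := fun i =>
      memLp_comp_of_map_eq (hm i) (hlaw i) hΨ.memLp_deriv
    have hprod : ∀ i, Integrable
        (fun ω => smallBallTest h v δ (fun j => ξ j ω) * deriv Ψ (ξ i ω)) P := fun i =>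
      hL.integrable_mul (hsc i)
    have hI := integrable_smallBallTestDeriv (h := h) (v := v) (P := P) hm hδ h
    have hQ := integrable_norm_sum_smul_sq
      (fun i => memLp_comp_of_map_eq (hm i) (hlaw i) hΨ.sq_integrable) v
    have hR := integrable_norm_sum_smul_sq hsc h
    have eQ : ∫ ω, ‖∑ i, ξ i ω • v i‖ ^ 2 ∂P = 1 * T := by
      refine integral_norm_sum_smul_sq hind
        (fun i => memLp_comp_of_map_eq (hm i) (hlaw i) hΨ.sq_integrable) (fun i => ?_)
        (fun i => ?_) v
      · rw [← hΨ.mean_zero]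
        exact integral_comp_of_map_eq (hm i) (hlaw i) measurable_id
      · rw [← hΨ.second_moment_one]
        exact integral_comp_of_map_eq (hm i) (hlaw i) (g := fun x => x ^ 2) (by fun_prop)
    have eR : ∫ ω, ‖∑ i, deriv Ψ (ξ i ω) • h i‖ ^ 2 ∂P = κ * 1 := by
      rw [← hh]
      have := integral_norm_sum_smul_sq (η := fun i ω => deriv Ψ (ξ i ω)) (s := κ)
        (hind.comp (fun _ => deriv Ψ) fun _ => hdm) hsc (fun i => ?_) (fun i => ?_) h
      · simpa using this
      · rw [← hΨ.integral_deriv_eq_zero]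
        exact integral_comp_of_map_eq (hm i) (hlaw i) hdm
      · exact integral_comp_of_map_eq (hm i) (hlaw i) (hdm.pow_const 2)
    -- After integration by parts the integrand is the test function times s = ∑ Ψ'(ξ_i) h_i. It is
    -- at most 2δy|s| ≤ δ(y² + s²), where y² has mean 1 + T and s² has mean κ.
    have eD : ∫ ω, smallBallTestDeriv h v δ h (fun j => ξ j ω) ∂P ≤ δ * (1 + T + κ) := by
      calc _ = ∫ ω, ∑ i, h i * smallBallTestDeriv h v δ (Pi.single i 1) (fun j => ξ j ω) ∂P := by
            simp only [← smallBallTestDeriv_eq_sum]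
        _ = ∑ i, h i * ∫ ω, smallBallTest h v δ (fun j => ξ j ω) * deriv Ψ (ξ i ω) ∂P := by
            rw [integral_finsetSum _ fun i _ =>
              (integrable_smallBallTestDeriv hm hδ (Pi.single i 1)).const_mul _]
            simp only [integral_const_mul,
              integral_smallBallTestDeriv_single hΨ hm hind hlaw hδ]
        _ = ∫ ω, ∑ i, h i * (smallBallTest h v δ (fun j => ξ j ω) * deriv Ψ (ξ i ω)) ∂P := by
            rw [integral_finsetSum _ fun i _ => (hprod i).const_mul _]
            simp only [integral_const_mul]
        _ ≤ ∫ ω, δ * ((1 + ‖∑ i, ξ i ω • v i‖ ^ 2) + ‖∑ i, deriv Ψ (ξ i ω) • h i‖ ^ 2) ∂P := by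
            refine integral_mono (integrable_finsetSum _ fun i _ => (hprod i).const_mul _)
              ((((integrable_const 1).add hQ).add hR).const_mul δ) fun ω => ?_
            have h1 := abs_smallBallTest_le (h := h) (v := v) hδ fun j => ξ j ω
            have h2 : ∑ i, h i * (smallBallTest h v δ (fun j => ξ j ω) * deriv Ψ (ξ i ω)) =
                smallBallTest h v δ (fun j => ξ j ω) * ∑ i, deriv Ψ (ξ i ω) * h i := by
              rw [Finset.mul_sum]
              exact Finset.sum_congr rfl fun i _ => by ring
            simp only [h2, ← regNorm_sq, Real.norm_eq_abs, smul_eq_mul, sq_abs]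
            set y := regNorm v fun j => ξ j ω
            set s := ∑ i, deriv Ψ (ξ i ω) * h i
            calc _ ≤ |smallBallTest h v δ (fun j => ξ j ω)| * |s| := by
                  rw [← abs_mul]; exact le_abs_self _
              _ ≤ 2 * δ * y * |s| := by gcongr
              _ = δ * (2 * y * |s|) := by ring
              _ ≤ δ * (y ^ 2 + s ^ 2) := by
                  gcongr
                  nlinarith [sq_nonneg (y - |s|), sq_abs s]
        _ = δ * (1 + T + κ) := by
            rw [integral_const_mul, integral_add (by exact (integrable_const 1).add hQ) hR,
              integral_add (integrable_const 1) hQ, eQ, eR]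
            simp
    set A := {ω | |∑ i, ξ i ω * h i| ≤ δ * ‖∑ i, ξ i ω • v i‖} with hA
    have hAm : MeasurableSet A := by
      have hc : Continuous fun x : ι → ℝ => ‖∑ i, x i • v i‖ := by fun_prop
      exact measurableSet_le (by fun_prop)
        ((hc.measurable.comp (measurable_pi_lambda _ hm)).const_mul δ)
    calc P.real A = ∫ ω, A.indicator 1 ω ∂P := (integral_indicator_one hAm).symm
      _ ≤ ∫ ω, (2 * smallBallTestDeriv h v δ h (fun j => ξ j ω) +
            6 * δ * ‖∑ i, h i • v i‖) ∂P := by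
          refine integral_mono ((integrable_const 1).indicator hAm)
            ((hI.const_mul 2).add (integrable_const _)) fun ω => ?_
          by_cases hω : ω ∈ A
          · rw [Set.indicator_of_mem hω]
            exact one_le_smallBallTestDeriv hh hδ _ hω
          · rw [Set.indicator_of_notMem hω]
            exact nonneg_smallBallTestDeriv hh hδ _
      _ = 2 * ∫ ω, smallBallTestDeriv h v δ h (fun j => ξ j ω) ∂P +
            6 * δ * ‖∑ i, h i • v i‖ := by
          rw [integral_add (hI.const_mul 2) (integrable_const _), integral_const_mul]
          simp
      _ ≤ 2 * (δ * (1 + T + κ)) + 6 * δ * (1 + T) := by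
          gcongr
          exact norm_sum_smul_le_one_add hh
      _ ≤ _ := by nlinarith [mul_nonneg (mul_nonneg hδ.le hT0) hκ0]
  -- The test function divides by its scale, so ε = 0 is reached as a limit from above. That value
  -- does occur, for intervals of length 0.
  have hlim : Filter.Tendsto (fun n : ℕ => (8 + 2 * κ) * (1 + T) * (ε + 1 / ((n : ℝ) + 1)))
      Filter.atTop (nhds ((8 + 2 * κ) * (1 + T) * (ε + 0))) :=
    (tendsto_one_div_add_atTop_nhds_zero_nat.const_add ε).const_mul _
  rw [add_zero] at hlim
  refine ge_of_tendsto' hlim fun n => ?_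
  have hn : 0 < 1 / ((n : ℝ) + 1) := by positivity
  refine le_trans (measureReal_mono fun ω hω => ?_) (pos _ (by positivity))
  have hω' : |∑ i, ξ i ω * h i| ≤ ε * ‖∑ i, ξ i ω • v i‖ := hω
  exact hω'.trans
    (mul_le_mul_of_nonneg_right (by linarith) (norm_nonneg _))

end SmallBallProbability

/-! ### Functions with many zeros are small at the midpoint. -/

section Interpolation

/-- Iterated Rolle theorem for an increasing tuple of zeros. -/
theorem exists_iteratedDeriv_eq_zero_of_strictMono {α β : ℝ} (m : ℕ) {f : ℝ → ℝ}
    (hf : ContDiff ℝ ((⊤ : ℕ∞) : WithTop ℕ∞) f) {t : Fin (m + 1) → ℝ} (ht : StrictMono t)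
    (htI : ∀ i, t i ∈ Set.Icc α β) (h0 : ∀ i, f (t i) = 0) :
    ∃ x ∈ Set.Icc α β, iteratedDeriv m f x = 0 := by
  induction m generalizing f with
  | zero => exact ⟨t 0, htI 0, by simpa using h0 0⟩
  | succ m ih =>
    have h1 : ∀ i : Fin (m + 1), ∃ s ∈ Set.Ioo (t i.castSucc) (t i.succ), deriv f s = 0 :=
      fun i => exists_deriv_eq_zero (ht i.castSucc_lt_succ) hf.continuous.continuousOn
        (by rw [h0, h0])
    choose s hs hs0 using h1
    have hd : ContDiff ℝ ((⊤ : ℕ∞) : WithTop ℕ∞) (deriv f) :=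
      (contDiff_infty_iff_deriv.1 hf).2
    have hmono : StrictMono s := fun i j hij =>
      ((hs i).2.trans_le (ht.monotone (Fin.succ_le_castSucc_iff.2 hij))).trans (hs j).1
    rw [iteratedDeriv_succ']
    exact ih hd hmono (fun i => ⟨(htI _).1.trans (hs i).1.le, (hs i).2.le.trans (htI _).2⟩) hs0

/-- Iterated Rolle theorem for a finite set of zeros. -/
theorem exists_iteratedDeriv_eq_zero {α β : ℝ} {m : ℕ} {f : ℝ → ℝ}
    (hf : ContDiff ℝ ((⊤ : ℕ∞) : WithTop ℕ∞) f) {s : Finset ℝ} (hs : s.card = m + 1)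
    (hsI : ∀ t ∈ s, t ∈ Set.Icc α β) (h0 : ∀ t ∈ s, f t = 0) :
    ∃ x ∈ Set.Icc α β, iteratedDeriv m f x = 0 :=
  exists_iteratedDeriv_eq_zero_of_strictMono m hf (s.orderEmbOfFin hs).strictMono
    (fun i => hsI _ (s.orderEmbOfFin_mem hs i)) (fun i => h0 _ (s.orderEmbOfFin_mem hs i))

theorem iteratedDeriv_eval (p : Polynomial ℝ) (m : ℕ) :
    iteratedDeriv m (fun x => p.eval x) = fun x => (Polynomial.derivative^[m] p).eval x := by
  induction m with
  | zero => simp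
  | succ m ih =>
    ext x
    rw [iteratedDeriv_succ, ih, Polynomial.deriv, Function.iterate_succ_apply']

theorem iteratedDeriv_card_prod_sub (s : Finset ℝ) (x : ℝ) :
    iteratedDeriv s.card (fun x => ∏ t ∈ s, (x - t)) x = s.card.factorial := by
  set p : Polynomial ℝ := ∏ t ∈ s, (Polynomial.X - Polynomial.C t) with hp
  have hmon : p.Monic := Polynomial.monic_prod_of_monic _ _ fun t _ => Polynomial.monic_X_sub_C t
  have hdeg : p.natDegree = s.card := by
    rw [hp, Polynomial.natDegree_prod_of_monic _ _ fun t _ => Polynomial.monic_X_sub_C t]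
    simp
  have h1 : (fun x => ∏ t ∈ s, (x - t)) = fun x => p.eval x := by
    ext x; simp [hp, Polynomial.eval_prod]
  rw [h1, iteratedDeriv_eval]
  have h2 : (Polynomial.derivative^[s.card] p).natDegree = 0 := by
    have := Polynomial.natDegree_iterate_derivative p s.card
    omega
  rw [Polynomial.eq_C_of_natDegree_eq_zero h2, Polynomial.coeff_iterate_derivative,
    zero_add, ← hdeg, hmon.coeff_natDegree]
  simp [Nat.descFactorial_self]

/-- The interpolation error formula for a function vanishing at the nodes. -/
theorem exists_mul_factorial_eq {α β c : ℝ} {f : ℝ → ℝ}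
    (hf : ContDiff ℝ ((⊤ : ℕ∞) : WithTop ℕ∞) f) {s : Finset ℝ}
    (hsI : ∀ t ∈ s, t ∈ Set.Icc α β) (h0 : ∀ t ∈ s, f t = 0) (hc : c ∈ Set.Icc α β) :
    ∃ x ∈ Set.Icc α β,
      f c * s.card.factorial = iteratedDeriv s.card f x * ∏ t ∈ s, (c - t) := by
  by_cases hcs : c ∈ s
  · exact ⟨c, hc, by rw [h0 c hcs, Finset.prod_eq_zero hcs (sub_self c)]; ring⟩
  have hw : ∏ t ∈ s, (c - t) ≠ 0 := Finset.prod_ne_zero_iff.2 fun t ht =>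
    sub_ne_zero.2 fun h => hcs (h ▸ ht)
  set w := ∏ t ∈ s, (c - t) with hwdef
  have hP : ContDiff ℝ ((⊤ : ℕ∞) : WithTop ℕ∞) fun x : ℝ => ∏ t ∈ s, (x - t) := by fun_prop
  -- Subtracting this multiple of the node polynomial creates one further zero, at c; Rolle then
  -- applies to `s.card + 1` zeros.
  have hQ : ContDiff ℝ ((⊤ : ℕ∞) : WithTop ℕ∞) fun x : ℝ => f c / w * ∏ t ∈ s, (x - t) :=
    contDiff_const.mul hP
  obtain ⟨x, hx, hx0⟩ := exists_iteratedDeriv_eq_zero (α := α) (β := β) (hf.sub hQ)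
    (s := insert c s) (Finset.card_insert_of_notMem hcs)
    (fun t ht => by
      rcases Finset.mem_insert.1 ht with rfl | ht
      exacts [hc, hsI t ht])
    (fun t ht => by
      rcases Finset.mem_insert.1 ht with rfl | ht
      · rw [← hwdef]; field_simp; ring
      · rw [h0 t ht, Finset.prod_eq_zero ht (sub_self t)]; ring)
  refine ⟨x, hx, ?_⟩
  have hn : ((s.card : ℕ∞) : WithTop ℕ∞) ≤ ((⊤ : ℕ∞) : WithTop ℕ∞) := by
    exact_mod_cast le_top
  have e1 := iteratedDeriv_sub (hf.contDiffAt.of_le hn) (hQ.contDiffAt.of_le hn) (x := x)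
  have e2 := iteratedDeriv_const_mul (f c / w) (hP.contDiffAt.of_le hn) (x := x)
  rw [iteratedDeriv_card_prod_sub] at e2
  have e3 : iteratedDeriv s.card f x - f c / w * s.card.factorial = 0 := by
    rw [← e2, ← e1]; exact hx0
  rw [sub_eq_zero.1 e3]
  field_simp

theorem Continuous.memLp_restrict_Icc {g : ℝ → ℝ} (hg : Continuous g) (α β : ℝ) (p : ℝ≥0∞) :
    MemLp g p (volume.restrict (Set.Icc α β)) := by
  obtain ⟨C, hC⟩ := isCompact_Icc.exists_bound_of_continuousOn (hg.continuousOn (s := Set.Icc α β))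
  exact MemLp.of_bound hg.aestronglyMeasurable C
    ((ae_restrict_iff' measurableSet_Icc).2 (Filter.Eventually.of_forall hC))

theorem setIntegral_abs_le {α β : ℝ} (hαβ : α ≤ β) {g : ℝ → ℝ} (hg : Continuous g) :
    ∫ x in Set.Icc α β, |g x| ≤ √(β - α) * √(∫ x in Set.Icc α β, g x ^ 2) := by
  have := integral_mul_norm_le_Lp_mul_Lq (μ := volume.restrict (Set.Icc α β))
    Real.HolderConjugate.two_two 
    ((continuous_const (y := (1 : ℝ))).memLp_restrict_Icc α β _) (hg.memLp_restrict_Icc α β _)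
  simpa [Real.sqrt_eq_rpow, max_eq_left (sub_nonneg.2 hαβ)] using this

/-- A function with `m + 1` zeros in an interval is small at the midpoint. -/
theorem abs_midpoint_le {α β : ℝ} {m : ℕ} {f : ℝ → ℝ}
    (hf : ContDiff ℝ ((⊤ : ℕ∞) : WithTop ℕ∞) f) {s : Finset ℝ} (hs : s.card = m + 1)
    (hsI : ∀ t ∈ s, t ∈ Set.Icc α β) (h0 : ∀ t ∈ s, f t = 0) :
    |f ((α + β) / 2)| ≤ ((β - α) / 2) ^ m / m.factorial * √(β - α) *
      √(∫ x in Set.Icc α β, iteratedDeriv (m + 1) f x ^ 2) := by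
  -- All m + 1 zeros are used for the zero z of the m-th derivative, but only m of them as nodes.
  -- The m-th derivative is then controlled by an L² norm of the next one, and a Hilbert norm is
  -- what the small ball estimate accepts.
  obtain ⟨z, hz, hz0⟩ := exists_iteratedDeriv_eq_zero hf hs hsI h0
  have hαβ : α ≤ β := hz.1.trans hz.2
  obtain ⟨t, ht⟩ : s.Nonempty := Finset.card_pos.1 (by omega)
  have hcard : (s.erase t).card = m := by rw [Finset.card_erase_of_mem ht, hs]; rfl
  obtain ⟨x, hx, hx0⟩ := exists_mul_factorial_eq (c := (α + β) / 2) hf (s := s.erase t)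
    (fun u hu => hsI u (Finset.mem_of_mem_erase hu)) (fun u hu => h0 u (Finset.mem_of_mem_erase hu))
    ⟨by linarith, by linarith⟩
  rw [hcard] at hx0
  have hcont : Continuous (iteratedDeriv (m + 1) f) :=
    hf.continuous_iteratedDeriv _ (by exact_mod_cast le_top)
  have hder : ∀ y, HasDerivAt (iteratedDeriv m f) (iteratedDeriv (m + 1) f y) y := fun y => by
    rw [iteratedDeriv_succ]
    exact (hf.differentiable_iteratedDeriv m (by exact_mod_cast WithTop.coe_lt_top m) y).hasDerivAt
  have hsup : |iteratedDeriv m f x| ≤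
      √(β - α) * √(∫ x in Set.Icc α β, iteratedDeriv (m + 1) f x ^ 2) := by
    refine le_trans ?_ (setIntegral_abs_le hαβ hcont)
    have h1 := intervalIntegral.integral_eq_sub_of_hasDerivAt (a := z) (b := x)
      (fun y _ => hder y) (hcont.intervalIntegrable _ _)
    rw [hz0, sub_zero] at h1
    rw [← h1]
    refine (intervalIntegral.norm_integral_le_integral_norm_uIoc (a := z) (b := x)
      (μ := volume) (f := iteratedDeriv (m + 1) f)).trans ?_
    refine setIntegral_mono_set (hcont.abs.continuousOn.integrableOn_Icc)
      (Filter.Eventually.of_forall fun y => abs_nonneg _) (LE.le.eventuallyLE ?_)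
    exact Set.uIoc_subset_uIcc.trans (Set.uIcc_subset_Icc hz hx)
  have hprod : |∏ u ∈ s.erase t, ((α + β) / 2 - u)| ≤ ((β - α) / 2) ^ m := by
    rw [Finset.abs_prod, ← hcard, ← Finset.prod_const]
    refine Finset.prod_le_prod (fun _ _ => abs_nonneg _) fun u hu => ?_
    have := hsI u (Finset.mem_of_mem_erase hu)
    rw [abs_le]
    constructor <;> linarith [this.1, this.2]
  have hfac : (0 : ℝ) < m.factorial := by positivity
  have h2 : |f ((α + β) / 2)| * m.factorial =
      |iteratedDeriv m f x| * |∏ u ∈ s.erase t, ((α + β) / 2 - u)| := by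
    rw [← abs_mul, ← hx0, abs_mul, abs_of_pos hfac]
  rw [← mul_le_mul_iff_left₀ hfac, h2]
  calc _ ≤ (√(β - α) * √(∫ x in Set.Icc α β, iteratedDeriv (m + 1) f x ^ 2)) *
        ((β - α) / 2) ^ m := by gcongr
    _ = _ := by field_simp

end Interpolation

/-! ### Measurability of the zero count, and bounded intervals. -/

section ZeroCount

theorem le_zeroCount_iff (f : ℝ → ℝ) (I : Set ℝ) (k : ℕ) :
    (k : ℕ∞) ≤ zeroCount f I ↔
      ∃ s : Finset ℝ, s.card = k ∧ ∀ t ∈ s, t ∈ I ∧ f t = 0 := by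
  unfold zeroCount
  constructor
  · intro h
    obtain ⟨t, ht, hk⟩ := Set.exists_subset_encard_eq h
    have hfin : t.Finite := Set.finite_of_encard_eq_coe hk
    refine ⟨hfin.toFinset, ?_, fun x hx => ht (hfin.mem_toFinset.1 hx)⟩
    rw [hfin.encard_eq_coe_toFinset_card] at hk
    exact_mod_cast hk
  · rintro ⟨s, hs, h⟩
    rw [← hs, ← Set.encard_coe_eq_coe_finsetCard]
    exact Set.encard_le_encard fun x hx => h x hx

/-- The event is the projection of the set of pairs (x, k distinct zeros in I). That set is locally
closed in a σ-compact, locally compact space, hence σ-compact, and so is its image. -/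
theorem measurableSet_le_zeroCount {E : Type*} [TopologicalSpace E] [LocallyCompactSpace E]
    [SecondCountableTopology E] [T2Space E] [MeasurableSpace E] [OpensMeasurableSpace E]
    {F : E → ℝ → ℝ} (hF : Continuous (Function.uncurry F)) {I : Set ℝ} (hI : IsLocallyClosed I)
    (k : ℕ) : MeasurableSet {x | (k : ℕ∞) ≤ zeroCount (F x) I} := by
  obtain ⟨U, Z, hU, hZ, rfl⟩ := hI
  set S : Set (E × (Fin k → ℝ)) :=
    ((⋂ i, ⋂ j, ⋂ (_ : i ≠ j), {p | p.2 i ≠ p.2 j}) ∩ ⋂ i, (fun p => p.2 i) ⁻¹' U) ∩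
      ((⋂ i, (fun p => p.2 i) ⁻¹' Z) ∩ ⋂ i, {p | F p.1 (p.2 i) = 0}) with hS
  have hlc : IsLocallyClosed S := by
    refine ⟨_, _, IsOpen.inter ?_ ?_, IsClosed.inter ?_ ?_, rfl⟩
    · refine isOpen_iInter_of_finite fun i => isOpen_iInter_of_finite fun j =>
        isOpen_iInter_of_finite fun _ => isOpen_ne_fun (by fun_prop) (by fun_prop)
    · exact isOpen_iInter_of_finite fun i => hU.preimage (by fun_prop)
    · exact isClosed_iInter fun i => hZ.preimage (by fun_prop)
    · refine isClosed_iInter fun i => isClosed_eq ?_ continuous_const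
      exact hF.comp (continuous_fst.prodMk ((continuous_apply i).comp continuous_snd))
  have himage : {x | (k : ℕ∞) ≤ zeroCount (F x) (U ∩ Z)} = Prod.fst '' S := by
    ext x
    change (k : ℕ∞) ≤ zeroCount (F x) (U ∩ Z) ↔ _
    rw [le_zeroCount_iff]
    constructor
    · rintro ⟨s, hs, h⟩
      have hmem := fun i => h _ (s.orderEmbOfFin_mem hs i)
      refine ⟨(x, s.orderEmbOfFin hs), ?_, rfl⟩
      simp only [hS, Set.mem_inter_iff, Set.mem_iInter]
      exact ⟨⟨fun i j hij => (s.orderEmbOfFin hs).injective.ne hij, fun i => (hmem i).1.1⟩,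
        fun i => (hmem i).1.2, fun i => (hmem i).2⟩
    · rintro ⟨⟨y, t⟩, hp, rfl⟩
      simp only [hS, Set.mem_inter_iff, Set.mem_iInter] at hp
      obtain ⟨⟨hinj, hpU⟩, hpZ, hp0⟩ := hp
      have hinj' : Function.Injective t := fun i j hij => by
        by_contra hne
        exact hinj i j hne hij
      refine ⟨Finset.univ.image t, by simp [Finset.card_image_of_injective _ hinj'], ?_⟩
      intro u hu
      obtain ⟨i, -, rfl⟩ := Finset.mem_image.1 hu
      exact ⟨⟨hpU i, hpZ i⟩, hp0 i⟩
  have := hlc.locallyCompactSpace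
  have hσ : IsSigmaCompact S := isSigmaCompact_iff_sigmaCompactSpace.2 inferInstance
  obtain ⟨K, hK, hKe⟩ := hσ.image continuous_fst
  rw [himage, ← hKe]
  exact MeasurableSet.iUnion fun n => (hK n).measurableSet

theorem measurable_zeroCount {E : Type*} [TopologicalSpace E] [LocallyCompactSpace E]
    [SecondCountableTopology E] [T2Space E] [MeasurableSpace E] [OpensMeasurableSpace E]
    {F : E → ℝ → ℝ} (hF : Continuous (Function.uncurry F)) {I : Set ℝ} (hI : IsLocallyClosed I) :
    Measurable fun x => zeroCount (F x) I := by
  rw [ENat.measurable_iff]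
  intro n
  have h : (fun x => zeroCount (F x) I) ⁻¹' {(n : ℕ∞)} =
      {x | (n : ℕ∞) ≤ zeroCount (F x) I} \ {x | ((n + 1 : ℕ) : ℕ∞) ≤ zeroCount (F x) I} := by
    ext x
    change zeroCount (F x) I = n ↔
      (n : ℕ∞) ≤ zeroCount (F x) I ∧ ¬ ((n + 1 : ℕ) : ℕ∞) ≤ zeroCount (F x) I
    rw [not_le, Nat.cast_add, Nat.cast_one, ENat.lt_add_one_iff (ENat.natCast_ne_top n)]
    exact ⟨fun h => ⟨h.ge, h.le⟩, fun h => le_antisymm h.2 h.1⟩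
  rw [h]
  exact (measurableSet_le_zeroCount hF hI n).diff (measurableSet_le_zeroCount hF hI (n + 1))

/-- A nonempty bounded interval lies between an open interval and its closure. -/
theorem exists_Ioo_subset_subset_Icc {I : Set ℝ} (hI : I.OrdConnected)
    (hb : Bornology.IsBounded I) (hne : I.Nonempty) :
    ∃ α β : ℝ, α ≤ β ∧ Set.Ioo α β ⊆ I ∧ I ⊆ Set.Icc α β := by
  have h1 := hb.bddBelow
  have h2 := hb.bddAbove
  refine ⟨sInf I, sSup I, csInf_le_csSup hne h1 h2, fun x hx => ?_,
    fun x hx => ⟨csInf_le h1 hx, le_csSup h2 hx⟩⟩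
  obtain ⟨u, hu, hux⟩ := exists_lt_of_csInf_lt hne hx.1
  obtain ⟨w, hw, hxw⟩ := exists_lt_of_lt_csSup hne hx.2
  exact hI.out hu hw ⟨hux.le, hxw.le⟩

/-- A nonempty bounded interval is a compact one with at most two points removed. -/
theorem isLocallyClosed_of_ordConnected {I : Set ℝ} (hI : I.OrdConnected)
    (hb : Bornology.IsBounded I) : IsLocallyClosed I := by
  rcases I.eq_empty_or_nonempty with rfl | hne
  · exact isClosed_empty.isLocallyClosed
  obtain ⟨α, β, hαβ, h1, h2⟩ := exists_Ioo_subset_subset_Icc hI hb hne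
  have hfin : (Set.Icc α β \ I).Finite := by
    refine (Set.toFinite {α, β}).subset ?_
    rw [← Set.Icc_sdiff_Ioo_same hαβ]
    exact Set.sdiff_subset_sdiff_right h1
  refine ⟨(Set.Icc α β \ I)ᶜ, Set.Icc α β, hfin.isClosed.isOpen_compl, isClosed_Icc, ?_⟩
  ext x
  constructor
  · exact fun hx => ⟨fun h => h.2 hx, h2 hx⟩
  · rintro ⟨hx, hx'⟩
    by_contra h
    exact hx ⟨hx', h⟩

theorem volume_real_eq_sub {I : Set ℝ} {α β : ℝ} (hαβ : α ≤ β) (h1 : Set.Ioo α β ⊆ I)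
    (h2 : I ⊆ Set.Icc α β) : volume.real I = β - α := by
  refine le_antisymm ?_ ?_
  · have := measureReal_mono (μ := volume) h2 (by simp)
    rwa [Real.volume_real_Icc_of_le hαβ] at this
  · have := measureReal_mono (μ := volume) h1 ((measure_mono h2).trans_lt (by simp)).ne
    rwa [Real.volume_real_Ioo_of_le hαβ] at this

end ZeroCount

/-! ### From tail bounds to moments. -/

section Moments

variable {Ω : Type*} [MeasurableSpace Ω] {P : Measure Ω}

theorem lintegral_rpow_sum_le {r : ℝ} (hr : 1 ≤ r) {f : ℕ → Ω → ℝ≥0∞}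
    (hf : ∀ j, Measurable (f j)) (n : ℕ) :
    (∫⁻ ω, (∑ j ∈ Finset.range n, f j ω) ^ r ∂P) ^ (1 / r) ≤
      ∑ j ∈ Finset.range n, (∫⁻ ω, f j ω ^ r ∂P) ^ (1 / r) := by
  have hr0 : 0 < r := by linarith
  induction n with
  | zero => simp [hr0]
  | succ n ih =>
    simp only [Finset.sum_range_succ]
    refine le_trans (ENNReal.lintegral_Lp_add_le (f := fun ω => ∑ j ∈ Finset.range n, f j ω)
      (Finset.measurable_fun_sum _ fun j _ => hf j).aemeasurable (hf n).aemeasurable hr) ?_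
    gcongr

theorem tsum_indicator_succ_le (z : ℕ∞) :
    ∑' j : ℕ, (if ((j + 1 : ℕ) : ℕ∞) ≤ z then (1 : ℝ≥0∞) else 0) = (z : ℝ≥0∞) := by
  induction z using ENat.recTopCoe with
  | top => simp
  | coe n =>
    rw [tsum_eq_sum (s := Finset.range n)]
    · rw [Finset.sum_congr rfl fun j hj => if_pos (by
        have := Finset.mem_range.1 hj
        exact_mod_cast this)]
      simp
    · intro j hj
      have : ¬ (j + 1 ≤ n) := fun h => hj (Finset.mem_range.2 h)
      exact if_neg (by exact_mod_cast this)

/-- Minkowski's inequality for a counting variable, written as a sum of indicators. -/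
theorem lintegral_rpow_le_of_tail_le [IsProbabilityMeasure P] {Z : Ω → ℕ∞} (hZ : Measurable Z)
    {r C : ℝ} (hr : 1 < r) (hC : 0 ≤ C) {m : ℕ → ℝ} (hm : ∀ j, 0 ≤ m j) (hsum : Summable m)
    (hP : ∀ j : ℕ, P.real {ω | ((j + 1 : ℕ) : ℕ∞) ≤ Z ω} ≤ C * m j ^ r) :
    ∫⁻ ω, ((Z ω : ℕ∞) : ℝ≥0∞) ^ r ∂P ≤ ENNReal.ofReal (C * (∑' j, m j) ^ r) := by
  have hr0 : 0 < r := by linarith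
  set f : ℕ → Ω → ℝ≥0∞ := fun j ω => if ((j + 1 : ℕ) : ℕ∞) ≤ Z ω then 1 else 0 with hf
  have hA : ∀ j : ℕ, MeasurableSet {ω | ((j + 1 : ℕ) : ℕ∞) ≤ Z ω} := fun j =>
    hZ (show MeasurableSet {z : ℕ∞ | ((j + 1 : ℕ) : ℕ∞) ≤ z} from trivial)
  have hfm : ∀ j, Measurable (f j) := fun j =>
    Measurable.ite (hA j) measurable_const measurable_const
  have hfr : ∀ j, (∫⁻ ω, f j ω ^ r ∂P) ^ (1 / r) ≤ ENNReal.ofReal (C ^ (1 / r) * m j) := by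
    intro j
    have h1 : ∀ ω, f j ω ^ r = {ω | ((j + 1 : ℕ) : ℕ∞) ≤ Z ω}.indicator 1 ω := fun ω => by
      by_cases h : ((j + 1 : ℕ) : ℕ∞) ≤ Z ω
      · rw [Set.indicator_of_mem (by exact h)]; simp [hf, -Nat.cast_add, h]
      · rw [Set.indicator_of_notMem (by exact h)]; simp [hf, -Nat.cast_add, h, hr0]
    simp only [h1]
    rw [lintegral_indicator_one (hA j), ← ofReal_measureReal,
      ENNReal.ofReal_rpow_of_nonneg measureReal_nonneg (by positivity)]
    refine ENNReal.ofReal_le_ofReal ?_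
    calc _ ≤ (C * m j ^ r) ^ (1 / r) :=
          Real.rpow_le_rpow measureReal_nonneg (hP j) (by positivity)
      _ = C ^ (1 / r) * m j := by
          rw [Real.mul_rpow hC (Real.rpow_nonneg (hm j) r), ← Real.rpow_mul (hm j),
            mul_one_div_cancel hr0.ne', Real.rpow_one]
  have hpart : ∀ n, ∫⁻ ω, (∑ j ∈ Finset.range n, f j ω) ^ r ∂P ≤
      ENNReal.ofReal (C * (∑' j, m j) ^ r) := by
    intro n
    have hS : 0 ≤ ∑' j, m j := tsum_nonneg hm
    have hC' : 0 ≤ C ^ (1 / r) := Real.rpow_nonneg hC _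
    have h1 : (∫⁻ ω, (∑ j ∈ Finset.range n, f j ω) ^ r ∂P) ^ (1 / r) ≤
        ENNReal.ofReal (C ^ (1 / r) * ∑' j, m j) := by
      refine (lintegral_rpow_sum_le hr.le hfm n).trans
        ((Finset.sum_le_sum fun j _ => hfr j).trans ?_)
      rw [← ENNReal.ofReal_sum_of_nonneg fun j _ => mul_nonneg hC' (hm j), ← Finset.mul_sum]
      exact ENNReal.ofReal_le_ofReal
        (mul_le_mul_of_nonneg_left (hsum.sum_le_tsum _ fun j _ => hm j) hC')
    have h2 := ENNReal.rpow_le_rpow h1 hr0.le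
    rw [← ENNReal.rpow_mul, one_div_mul_cancel hr0.ne', ENNReal.rpow_one,
      ENNReal.ofReal_rpow_of_nonneg (mul_nonneg hC' hS) hr0.le, Real.mul_rpow hC' hS,
      ← Real.rpow_mul hC, one_div_mul_cancel hr0.ne', Real.rpow_one] at h2
    exact h2
  have hlim : Filter.Tendsto (fun n => ∫⁻ ω, (∑ j ∈ Finset.range n, f j ω) ^ r ∂P)
      Filter.atTop (nhds (∫⁻ ω, ((Z ω : ℕ∞) : ℝ≥0∞) ^ r ∂P)) := by
    refine lintegral_tendsto_of_tendsto_of_monotone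
      (fun n => ((Finset.measurable_fun_sum _ fun j _ => hfm j).pow_const r).aemeasurable)
      (Filter.Eventually.of_forall fun ω n k hnk => ?_)
      (Filter.Eventually.of_forall fun ω => ?_)
    · exact ENNReal.rpow_le_rpow
        (Finset.sum_le_sum_of_subset (Finset.range_mono hnk)) hr0.le
    · rw [← tsum_indicator_succ_le (Z ω)]
      exact (ENNReal.continuous_rpow_const.tendsto _).comp (ENNReal.tendsto_nat_tsum _)
  exact le_of_tendsto' hlim hpart

theorem momentTerm_nonneg {ℓ r : ℝ} (hℓ : 0 ≤ ℓ) (k : ℕ) : 0 ≤ momentTerm ℓ r k := by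
  unfold momentTerm; positivity

/-- The r-th power of a term of the series is the tail bound without its constant, as
`lintegral_rpow_le_of_tail_le` requires. -/
theorem momentTerm_rpow {ℓ r : ℝ} (hℓ : 0 ≤ ℓ) (hr : 1 < r) (k : ℕ) :
    momentTerm ℓ r k ^ r =
      ((k.factorial : ℝ) * ((k - 1).factorial : ℝ)) ^ (-(1 / 2 : ℝ)) * ℓ ^ ((k : ℝ) - 1 / 2) := by
  have hr0 : r ≠ 0 := by linarith
  have hF : (0 : ℝ) ≤ (k.factorial : ℝ) * ((k - 1).factorial : ℝ) := by positivity
  unfold momentTerm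
  rw [Real.div_rpow (by positivity) (by positivity), ← Real.rpow_mul hℓ, ← Real.rpow_mul hF,
    Real.rpow_neg hF, div_eq_mul_inv, mul_comm]
  congr 2
  · congr 1; field_simp
  · field_simp

theorem momentTerm_succ_succ {ℓ r : ℝ} (hℓ : 0 < ℓ) (hr : 1 < r) (j : ℕ) :
    momentTerm ℓ r (j + 2) =
      ℓ ^ (1 / r) / (((j : ℝ) + 2) * ((j : ℝ) + 1)) ^ (1 / (2 * r)) * momentTerm ℓ r (j + 1) := by
  have hr0 : r ≠ 0 := by linarith
  unfold momentTerm
  have e1 : (2 * ((j + 2 : ℕ) : ℝ) - 1) / (2 * r) =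
      1 / r + (2 * ((j + 1 : ℕ) : ℝ) - 1) / (2 * r) := by
    push_cast; field_simp; ring
  have e2 : ((j + 2).factorial : ℝ) * ((j + 2 - 1).factorial : ℝ) =
      (((j : ℝ) + 2) * ((j : ℝ) + 1)) * (((j + 1).factorial : ℝ) * ((j + 1 - 1).factorial : ℝ)) := by
    rw [show j + 2 - 1 = j + 1 from rfl, show j + 1 - 1 = j from rfl, Nat.factorial_succ (j + 1),
      Nat.factorial_succ j]
    push_cast; ring
  rw [e1, e2, Real.rpow_add hℓ, Real.mul_rpow (by positivity) (by positivity)]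
  exact mul_div_mul_comm _ _ _ _

theorem summable_momentTerm {ℓ r : ℝ} (hℓ : 0 ≤ ℓ) (hr : 1 < r) :
    Summable fun j : ℕ => momentTerm ℓ r (j + 1) := by
  have hr0 : 0 < r := by linarith
  rcases hℓ.eq_or_lt with rfl | hℓ
  · refine summable_of_ne_finset_zero (s := ∅) fun j _ => ?_
    have : (2 * ((j + 1 : ℕ) : ℝ) - 1) / (2 * r) ≠ 0 := by
      have : (0 : ℝ) < 2 * ((j + 1 : ℕ) : ℝ) - 1 := by
        push_cast; linarith [(Nat.cast_nonneg j : (0 : ℝ) ≤ j)]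
      positivity
    rw [momentTerm, Real.zero_rpow this, zero_div]
  · have hlim : Filter.Tendsto
        (fun j : ℕ => ℓ ^ (1 / r) / (((j : ℝ) + 2) * ((j : ℝ) + 1)) ^ (1 / (2 * r)))
        Filter.atTop (nhds 0) := by
      refine Filter.Tendsto.const_div_atTop ((tendsto_rpow_atTop (by positivity)).comp ?_) _
      exact (Filter.tendsto_atTop_add_const_right _ _ tendsto_natCast_atTop_atTop).atTop_mul_atTop₀
        (Filter.tendsto_atTop_add_const_right _ _ tendsto_natCast_atTop_atTop)
    refine summable_of_ratio_norm_eventually_le (r := 1 / 2) (by norm_num) ?_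
    filter_upwards [hlim.eventually_le_const (show (0 : ℝ) < 1 / 2 by norm_num)] with j hj
    rw [Real.norm_of_nonneg (momentTerm_nonneg hℓ.le _),
      Real.norm_of_nonneg (momentTerm_nonneg hℓ.le _), momentTerm_succ_succ hℓ hr]
    exact mul_le_mul_of_nonneg_right hj (momentTerm_nonneg hℓ.le _)

end Moments

/-! ### Linear combinations in L² of an interval. -/

section SquareIntegrable

variable {ι : Type*} [Fintype ι]

/-- The norm of a combination of continuous functions in `L²` of a compact interval. -/
theorem norm_sum_smul_toLp {α β : ℝ} {g : ι → ℝ → ℝ}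
    (hg : ∀ i, MemLp (g i) 2 (volume.restrict (Set.Icc α β))) (x : ι → ℝ) :
    ‖∑ i, x i • (hg i).toLp (g i)‖ = √(∫ t in Set.Icc α β, (∑ i, x i * g i t) ^ 2) := by
  rw [eq_comm, Real.sqrt_eq_iff_eq_sq (integral_nonneg fun t => sq_nonneg _) (norm_nonneg _),
    ← real_inner_self_eq_norm_sq, L2.inner_def]
  refine integral_congr_ae ?_
  have h1 : ∀ᵐ t ∂(volume.restrict (Set.Icc α β)), ∀ i, (x i • (hg i).toLp (g i) : Lp ℝ 2 _) t =
      x i * g i t := by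
    refine ae_all_iff.2 fun i => ?_
    filter_upwards [Lp.coeFn_smul (x i) ((hg i).toLp (g i)), (hg i).coeFn_toLp] with t h2 h3
    rw [h2, Pi.smul_apply, h3, smul_eq_mul]
  have h2 := Lp.coeFn_finsetSum Finset.univ (fun i => (x i • (hg i).toLp (g i) : Lp ℝ 2 _))
  filter_upwards [h1, h2] with t h3 h4
  rw [h4, Finset.sum_apply, Finset.sum_congr rfl fun i _ => h3 i]
  simp [sq]

end SquareIntegrable

/-! ### The trigonometric family and its zeros. -/

section TrigBasis

/-- The functions whose combinations with the coefficients as weights give `trigPoly`. -/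
noncomputable def trigBasis (N : ℕ) : Fin N ⊕ Fin N → ℝ → ℝ :=
  Sum.elim (fun n t => 1 / √(N : ℝ) * Real.cos (((n : ℝ) + 1) / N * t))
    (fun n t => 1 / √(N : ℝ) * Real.sin (((n : ℝ) + 1) / N * t))

theorem trigPoly_eq_sum {Ω : Type*} (a b : ℕ → Ω → ℝ) (N : ℕ) (ω : Ω) (t : ℝ) :
    trigPoly a b N ω t =
      ∑ i, Sum.elim a b (Sum.map Fin.val Fin.val i) ω * trigBasis N i t := by
  rw [trigPoly, Fintype.sum_sum_type, ← Finset.sum_add_distrib, Finset.sum_range, Finset.mul_sum]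
  refine Finset.sum_congr rfl fun n _ => ?_
  simp only [trigBasis, Sum.map_inl, Sum.map_inr, Sum.elim_inl, Sum.elim_inr, mul_div_right_comm]
  ring

theorem contDiff_trigBasis (N : ℕ) (i : Fin N ⊕ Fin N) :
    ContDiff ℝ ((⊤ : ℕ∞) : WithTop ℕ∞) (trigBasis N i) := by
  rcases i with n | n <;> simp only [trigBasis, Sum.elim_inl, Sum.elim_inr] <;> fun_prop

theorem iteratedDeriv_mul_cos (q w : ℝ) (m : ℕ) :
    iteratedDeriv m (fun t => q * Real.cos (w * t)) =
      fun t => q * w ^ m * Real.cos (w * t + m * (Real.pi / 2)) := by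
  induction m with
  | zero => simp
  | succ m ih =>
    ext t
    rw [iteratedDeriv_succ, ih]
    have h1 : HasDerivAt (fun t => w * t + m * (Real.pi / 2)) w t := by
      simpa using ((hasDerivAt_id t).const_mul w).add_const (m * (Real.pi / 2))
    rw [(h1.cos.const_mul (q * w ^ m)).deriv, show w * t + ((m + 1 : ℕ) : ℝ) * (Real.pi / 2) =
      w * t + m * (Real.pi / 2) + Real.pi / 2 by push_cast; ring, Real.cos_add_pi_div_two]
    ring

theorem iteratedDeriv_mul_sin (q w : ℝ) (m : ℕ) :
    iteratedDeriv m (fun t => q * Real.sin (w * t)) =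
      fun t => q * w ^ m * Real.sin (w * t + m * (Real.pi / 2)) := by
  induction m with
  | zero => simp
  | succ m ih =>
    ext t
    rw [iteratedDeriv_succ, ih]
    have h1 : HasDerivAt (fun t => w * t + m * (Real.pi / 2)) w t := by
      simpa using ((hasDerivAt_id t).const_mul w).add_const (m * (Real.pi / 2))
    rw [(h1.sin.const_mul (q * w ^ m)).deriv, show w * t + ((m + 1 : ℕ) : ℝ) * (Real.pi / 2) =
      w * t + m * (Real.pi / 2) + Real.pi / 2 by push_cast; ring, Real.sin_add_pi_div_two]
    ring

/-- Differentiation shifts the cosine and the sine by the same phase, so their squares still add up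
to 1 and t disappears. Order 0 normalises the linear form; higher orders have frequencies at most 1.
-/
theorem sum_iteratedDeriv_trigBasis_sq {N : ℕ} (m : ℕ) (t : ℝ) :
    ∑ i, iteratedDeriv m (trigBasis N i) t ^ 2 =
      ∑ n : Fin N, 1 / (N : ℝ) * (((n : ℝ) + 1) / N) ^ (2 * m) := by
  rw [Fintype.sum_sum_type, ← Finset.sum_add_distrib]
  refine Finset.sum_congr rfl fun n _ => ?_
  simp only [trigBasis, Sum.elim_inl, Sum.elim_inr]
  rw [iteratedDeriv_mul_cos, iteratedDeriv_mul_sin]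
  have h1 : (1 / √(N : ℝ)) ^ 2 = 1 / N := by
    rw [div_pow, Real.sq_sqrt (Nat.cast_nonneg N), one_pow]
  calc _ = (1 / √(N : ℝ)) ^ 2 * (((n : ℝ) + 1) / N) ^ (2 * m) *
        (Real.sin (((n : ℝ) + 1) / N * t + m * (Real.pi / 2)) ^ 2 +
          Real.cos (((n : ℝ) + 1) / N * t + m * (Real.pi / 2)) ^ 2) := by ring
    _ = _ := by rw [Real.sin_sq_add_cos_sq, h1, mul_one]

theorem sum_trigBasis_sq {N : ℕ} (hN : 1 ≤ N) (t : ℝ) : ∑ i, trigBasis N i t ^ 2 = 1 := by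
  have := sum_iteratedDeriv_trigBasis_sq (N := N) 0 t
  have hN' : (N : ℝ) ≠ 0 := by positivity
  simpa [hN'] using this

theorem sum_iteratedDeriv_trigBasis_sq_le {N : ℕ} (hN : 1 ≤ N) (m : ℕ) (t : ℝ) :
    ∑ i, iteratedDeriv m (trigBasis N i) t ^ 2 ≤ 1 := by
  have hN' : (0 : ℝ) < N := by positivity
  rw [sum_iteratedDeriv_trigBasis_sq]
  calc _ ≤ ∑ n : Fin N, 1 / (N : ℝ) := by
        refine Finset.sum_le_sum fun n _ => mul_le_of_le_one_right (by positivity)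
          (pow_le_one₀ (by positivity) ((div_le_one hN').2 ?_))
        exact_mod_cast n.isLt
    _ = 1 := by simp [hN'.ne']

/-- The coefficients entering `trigPoly`, as a finite family. -/
theorem IIDCoefficients.iIndepFun_fin {Ω : Type*} [MeasurableSpace Ω] {P : Measure Ω} {Ψ : ℝ → ℝ}
    {a b : ℕ → Ω → ℝ} (h : IIDCoefficients P Ψ a b) (N : ℕ) :
    iIndepFun (fun i : Fin N ⊕ Fin N => Sum.elim a b (Sum.map Fin.val Fin.val i)) P :=
  h.indep.precomp (Fin.val_injective.sumMap Fin.val_injective)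

theorem IIDCoefficients.measurable_elim {Ω : Type*} [MeasurableSpace Ω] {P : Measure Ω}
    {Ψ : ℝ → ℝ} {a b : ℕ → Ω → ℝ} (h : IIDCoefficients P Ψ a b) (i : ℕ ⊕ ℕ) :
    Measurable (Sum.elim a b i) := by
  rcases i with n | n
  exacts [h.measurable_a n, h.measurable_b n]

theorem IIDCoefficients.map_elim {Ω : Type*} [MeasurableSpace Ω] {P : Measure Ω}
    {Ψ : ℝ → ℝ} {a b : ℕ → Ω → ℝ} (h : IIDCoefficients P Ψ a b) (i : ℕ ⊕ ℕ) :
    P.map (Sum.elim a b i) = densityLaw Ψ := by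
  rcases i with n | n
  exacts [h.law_a n, h.law_b n]

theorem measurable_zeroCount_trigPoly {Ω : Type*} [MeasurableSpace Ω] {P : Measure Ω}
    {Ψ : ℝ → ℝ} {a b : ℕ → Ω → ℝ} (h : IIDCoefficients P Ψ a b) {I : Set ℝ} (hI : I.OrdConnected)
    (hb : Bornology.IsBounded I) (N : ℕ) :
    Measurable fun ω => zeroCount (trigPoly a b N ω) I := by
  have hF : Continuous (Function.uncurry fun (x : Fin N ⊕ Fin N → ℝ) t =>
      ∑ i, x i * trigBasis N i t) := by
    refine continuous_finsetSum _ fun i _ => ?_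
    exact ((continuous_apply i).comp continuous_fst).mul
      ((contDiff_trigBasis N i).continuous.comp continuous_snd)
  have := (measurable_zeroCount hF (isLocallyClosed_of_ordConnected hI hb)).comp
    (measurable_pi_lambda _ fun i : Fin N ⊕ Fin N =>
      h.measurable_elim (Sum.map Fin.val Fin.val i))
  convert this using 2 with ω
  exact congrArg (zeroCount · I) (funext fun t => trigPoly_eq_sum a b N ω t)

/-- The event lies in the small ball event with h the basis values at the midpoint and v the
derivatives of order m + 1 in L²([α, β]). -/
theorem measureReal_le_zeroCount_trigPoly {Ψ : ℝ → ℝ} (hΨ : AdmissiblePotential Ψ)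
    {Ω : Type*} [MeasurableSpace Ω] {P : Measure Ω} [IsProbabilityMeasure P]
    {a b : ℕ → Ω → ℝ} (h : IIDCoefficients P Ψ a b) {I : Set ℝ} {α β : ℝ} (hαβ : α ≤ β)
    (hI : I ⊆ Set.Icc α β) {N : ℕ} (hN : 1 ≤ N) (m : ℕ) :
    P.real {ω | ((m + 1 : ℕ) : ℕ∞) ≤ zeroCount (trigPoly a b N ω) I} ≤
      (8 + 2 * ∫ x, deriv Ψ x ^ 2 ∂(densityLaw Ψ)) * (1 + (β - α)) *
        (((β - α) / 2) ^ m / m.factorial * √(β - α)) := by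
  set g : Fin N ⊕ Fin N → ℝ → ℝ := fun i => iteratedDeriv (m + 1) (trigBasis N i) with hg
  have hgc : ∀ i, Continuous (g i) := fun i =>
    (contDiff_trigBasis N i).continuous_iteratedDeriv _ (by exact_mod_cast le_top)
  have hgL : ∀ i, MemLp (g i) 2 (volume.restrict (Set.Icc α β)) := fun i =>
    (hgc i).memLp_restrict_Icc α β 2
  have hℓ : 0 ≤ β - α := sub_nonneg.2 hαβ
  have hε : 0 ≤ ((β - α) / 2) ^ m / m.factorial * √(β - α) := by positivity
  have hT : ∑ i, ‖(hgL i).toLp (g i)‖ ^ 2 ≤ β - α := by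
    have h1 : ∀ i, ‖(hgL i).toLp (g i)‖ ^ 2 = ∫ t in Set.Icc α β, g i t ^ 2 := fun i => by
      classical
      have := norm_sum_smul_toLp hgL (Pi.single i 1)
      simp only [Pi.single_apply, ite_smul, one_smul, zero_smul, Finset.sum_ite_eq',
        Finset.mem_univ, if_true, ite_mul, one_mul, zero_mul] at this
      rw [this, Real.sq_sqrt (integral_nonneg fun t => sq_nonneg _)]
    have h2 : ∀ i, IntegrableOn (fun t => g i t ^ 2) (Set.Icc α β) := fun i =>
      ((hgc i).pow 2).continuousOn.integrableOn_Icc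
    simp only [h1]
    rw [← integral_finsetSum _ fun i _ => h2 i]
    refine (setIntegral_mono (g := fun _ => (1 : ℝ)) (integrable_finsetSum _ fun i _ => h2 i)
      (by simp) fun t => sum_iteratedDeriv_trigBasis_sq_le hN (m + 1) t).trans (le_of_eq ?_)
    simp [hℓ]
  have key := measureReal_abs_sum_le_mul_norm hΨ
    (fun i => h.measurable_elim (Sum.map Fin.val Fin.val i)) (h.iIndepFun_fin N)
    (fun i => h.map_elim _) (sum_trigBasis_sq hN ((α + β) / 2)) (fun i => (hgL i).toLp (g i)) hε
  have hκ : 0 ≤ ∫ x, deriv Ψ x ^ 2 ∂(densityLaw Ψ) := integral_nonneg fun x => sq_nonneg _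
  refine le_trans (measureReal_mono fun ω hω => ?_) (key.trans (by gcongr))
  obtain ⟨s, hs, hs0⟩ := (le_zeroCount_iff _ I (m + 1)).1 hω
  set x : Fin N ⊕ Fin N → ℝ := fun i => Sum.elim a b (Sum.map Fin.val Fin.val i) ω with hx
  have hfe : trigPoly a b N ω = fun t => ∑ i, x i * trigBasis N i t :=
    funext fun t => trigPoly_eq_sum a b N ω t
  have hf : ContDiff ℝ ((⊤ : ℕ∞) : WithTop ℕ∞) (trigPoly a b N ω) := by
    rw [hfe]
    exact ContDiff.sum fun i _ => contDiff_const.mul (contDiff_trigBasis N i)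
  have hder : ∀ t, iteratedDeriv (m + 1) (trigPoly a b N ω) t = ∑ i, x i * g i t := fun t => by
    have hn : (((m + 1 : ℕ) : ℕ∞) : WithTop ℕ∞) ≤ ((⊤ : ℕ∞) : WithTop ℕ∞) := by
      exact_mod_cast le_top
    have hb : ∀ i, ContDiffAt ℝ ((m + 1 : ℕ) : WithTop ℕ∞) (trigBasis N i) t := fun i =>
      (contDiff_trigBasis N i).contDiffAt.of_le hn
    rw [hfe, iteratedDeriv_fun_sum fun i _ => contDiffAt_const.mul (hb i)]
    exact Finset.sum_congr rfl fun i _ => iteratedDeriv_const_mul (x i) (hb i)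
  have hmid := abs_midpoint_le hf hs (fun t ht => hI (hs0 t ht).1) fun t ht => (hs0 t ht).2
  simp only [hder] at hmid
  rw [← norm_sum_smul_toLp hgL x, trigPoly_eq_sum] at hmid
  exact hmid

end TrigBasis

/-! ### Comparison of constants. -/

section Constants

theorem succ_mul_add_two_le (m : ℕ) : (m + 1) * (m + 2) ≤ 4 * 2 ^ m := by
  induction m with
  | zero => norm_num
  | succ m ih =>
    rcases m.eq_zero_or_pos with rfl | hm
    · norm_num
    · rw [pow_succ]; nlinarith

theorem le_of_le_midpoint_bound {ℓ K p : ℝ} (hℓ : 0 ≤ ℓ) (hK : 8 ≤ K) (m : ℕ) (hp : p ≤ 1)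
    (hpK : p ≤ K * (1 + ℓ) * ((ℓ / 2) ^ m / m.factorial * √ℓ)) :
    p ≤ 4 * K * (((m + 1).factorial : ℝ) * ((m + 1 - 1).factorial : ℝ)) ^ (-(1 / 2 : ℝ)) *
      ℓ ^ (((m + 1 : ℕ) : ℝ) - 1 / 2) := by
  have hm0 : (0 : ℝ) < m + 1 := by positivity
  have hs : 0 < √((m : ℝ) + 1) := Real.sqrt_pos.2 hm0
  have hfac : (0 : ℝ) < m.factorial := by positivity
  have e1 : (((m + 1).factorial : ℝ) * ((m + 1 - 1).factorial : ℝ)) ^ (-(1 / 2 : ℝ)) =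
      1 / (m.factorial * √((m : ℝ) + 1)) := by
    rw [Real.rpow_neg (by positivity), ← Real.sqrt_eq_rpow, Nat.add_sub_cancel, Nat.factorial_succ,
      ← one_div]
    congr 1
    rw [show (((m + 1) * m.factorial : ℕ) : ℝ) * (m.factorial : ℝ) =
      (m.factorial : ℝ) ^ 2 * ((m : ℝ) + 1) by push_cast; ring,
      Real.sqrt_mul (by positivity), Real.sqrt_sq hfac.le]
  have e2 : ℓ ^ (((m + 1 : ℕ) : ℝ) - 1 / 2) = ℓ ^ m * √ℓ := by
    rw [show ((m + 1 : ℕ) : ℝ) - 1 / 2 = m + 1 / 2 by push_cast; ring,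
      Real.rpow_add_of_nonneg hℓ (by positivity) (by norm_num), Real.rpow_natCast,
      Real.sqrt_eq_rpow]
  rw [e1, e2]
  -- For ℓ ≤ m + 1 the factor 2^m beats (1 + ℓ)√(m + 1). For ℓ ≥ m + 1 the claimed bound is at least
  -- 1, since m! √(m + 1) ≤ ℓ^m √ℓ.
  rcases le_total ℓ (m + 1) with hle | hle
  · refine hpK.trans ?_
    have h1 : √((m : ℝ) + 1) ≤ m + 1 := by
      rw [Real.sqrt_le_left hm0.le]; nlinarith [(Nat.cast_nonneg m : (0 : ℝ) ≤ m)]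
    have h2 : (1 + ℓ) * √((m : ℝ) + 1) ≤ 4 * 2 ^ m := by
      have h3 : (((m + 1) * (m + 2) : ℕ) : ℝ) ≤ ((4 * 2 ^ m : ℕ) : ℝ) := by
        exact_mod_cast succ_mul_add_two_le m
      push_cast at h3
      calc (1 + ℓ) * √((m : ℝ) + 1) ≤ (m + 2) * (m + 1) :=
            mul_le_mul (by linarith) h1 hs.le (by positivity)
        _ ≤ _ := by linarith
    have h4 : (1 + ℓ) / 2 ^ m ≤ 4 / √((m : ℝ) + 1) := by
      rw [div_le_div_iff₀ (by positivity) hs]; exact h2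
    calc K * (1 + ℓ) * ((ℓ / 2) ^ m / m.factorial * √ℓ)
        = (1 + ℓ) / 2 ^ m * (K * (ℓ ^ m * √ℓ) / m.factorial) := by
          rw [div_pow]; field_simp
      _ ≤ 4 / √((m : ℝ) + 1) * (K * (ℓ ^ m * √ℓ) / m.factorial) := by
          gcongr
      _ = _ := by field_simp
  · refine hp.trans ?_
    have h1 : (m.factorial : ℝ) ≤ ℓ ^ m := by
      calc (m.factorial : ℝ) ≤ (m : ℝ) ^ m := by exact_mod_cast Nat.factorial_le_pow m
        _ ≤ ℓ ^ m := by gcongr; linarith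
    have h2 : m.factorial * √((m : ℝ) + 1) ≤ ℓ ^ m * √ℓ := by gcongr
    have h3 : 1 ≤ 1 / (m.factorial * √((m : ℝ) + 1)) * (ℓ ^ m * √ℓ) := by
      rw [one_div_mul_eq_div, le_div_iff₀ (by positivity), one_mul]
      exact h2
    rw [mul_assoc]
    nlinarith

end Constants

theorem lemma3p7 (Ψ : ℝ → ℝ) (hΨ : AdmissiblePotential Ψ) :
    ∃ C : ℝ, 0 < C ∧
      ∀ (Ω : Type*) [MeasurableSpace Ω] (P : Measure Ω) [IsProbabilityMeasure P]
        (a b : ℕ → Ω → ℝ), IIDCoefficients P Ψ a b →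
      ∀ I : Set ℝ, I.OrdConnected → Bornology.IsBounded I →
      ∀ N : ℕ, 1 ≤ N →
        Measurable (fun ω => zeroCount (trigPoly a b N ω) I) ∧
        (∀ k : ℕ, 1 ≤ k →
          P.real {ω | (k : ℕ∞) ≤ zeroCount (trigPoly a b N ω) I} ≤
            C * ((k.factorial : ℝ) * ((k - 1).factorial : ℝ)) ^ (-(1 / 2 : ℝ)) *
              volume.real I ^ ((k : ℝ) - 1 / 2)) ∧
        (∀ r : ℝ, 1 < r →
          Summable (fun j : ℕ => momentTerm (volume.real I) r (j + 1)) ∧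
          ∫⁻ ω, ((zeroCount (trigPoly a b N ω) I : ℕ∞) : ℝ≥0∞) ^ r ∂P ≤
            ENNReal.ofReal
              (C * (∑' j : ℕ, momentTerm (volume.real I) r (j + 1)) ^ r)) := by
  have hκ : 0 ≤ ∫ x, deriv Ψ x ^ 2 ∂(densityLaw Ψ) := integral_nonneg fun x => sq_nonneg _
  set K := 8 + 2 * ∫ x, deriv Ψ x ^ 2 ∂(densityLaw Ψ) with hK
  have hK8 : 8 ≤ K := by linarith
  refine ⟨4 * K, by linarith, fun Ω _ P _ a b hab I hI hb N hN => ?_⟩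
  have hZ := measurable_zeroCount_trigPoly hab hI hb N
  have hℓ : 0 ≤ volume.real I := measureReal_nonneg
  have htail : ∀ m : ℕ, P.real {ω | ((m + 1 : ℕ) : ℕ∞) ≤ zeroCount (trigPoly a b N ω) I} ≤
      4 * K * (((m + 1).factorial : ℝ) * ((m + 1 - 1).factorial : ℝ)) ^ (-(1 / 2 : ℝ)) *
        volume.real I ^ (((m + 1 : ℕ) : ℝ) - 1 / 2) := by
    intro m
    refine le_of_le_midpoint_bound hℓ hK8 m measureReal_le_one ?_
    -- The endpoints are the infimum and supremum of I, hence the separate empty case.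
    rcases I.eq_empty_or_nonempty with rfl | hne
    · simp [zeroCount]
    · obtain ⟨α, β, hαβ, h1, h2⟩ := exists_Ioo_subset_subset_Icc hI hb hne
      rw [volume_real_eq_sub hαβ h1 h2]
      exact measureReal_le_zeroCount_trigPoly hΨ hab hαβ h2 hN m
  refine ⟨hZ, fun k hk => ?_, fun r hr => ⟨summable_momentTerm hℓ hr, ?_⟩⟩
  · obtain ⟨m, rfl⟩ := Nat.exists_eq_add_of_le' hk
    exact htail m
  · refine lintegral_rpow_le_of_tail_le hZ hr (by linarith) (fun j => momentTerm_nonneg hℓ _)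
      (summable_momentTerm hℓ hr) fun j => ?_
    rw [momentTerm_rpow hℓ hr, ← mul_assoc]
    exact htail j
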